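/- **Theorem (query time of the greedy range tree).** Fix constants $\alpha>1$ and $\beta\ge 1$. There is a constant $C>0$, depending only on $\alpha$ and $\beta$, such that the following holds. Let $m\ge 1$, let $\mathsf d_1,\dots,\mathsf d_m$ be metrics on a set $X$, and let $P\subseteq X$ be a finite set with at least two points. Let $\delta_i=\log_2\rho_i$ be the doubling dimension of $(P,\mathsf d_i)$, where $\rho_i$ is the least integer such that every closed ball of radius $s>0$ in $(P,\mathsf d_i)$ is covered by $\rho_i$ closed balls of radius $s/2$ centered in $P$. Put $\delta=\sum_{i=1}^m\delta_i$, and let $\Delta$ be the maximum over $i$ of the spread of $(P,\mathsf d_i)$ (largest divided by smallest distance between distinct points). A *greedy tree* on a finite nonempty set $S$ with metric $\mathsf d$ is given by an ordering $p_0,\dots,p_n$ of $S$ and predecessors $T(p_i)\in P_i=\{p_0,\dots,p_{i-1}\}$ for $i>0$ such that $\mathsf d(p_j,P_i)\le\beta\,\mathsf d(p_i,P_i)$ for all $j\ge i>0$ (for $\beta=1$ this is a greedy permutation), $\mathsf d(p_i,T(p_i))\le\beta\,\mathsf d(p_i,P_i)$, and $\alpha\,\mathsf d(p_i,T(p_i))\le\mathsf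 d(T(p_i),T(T(p_i)))$ whenever $T(p_i)\ne p_0$. It is the binary tree obtained from the single leaf $p_0$ by inserting $p_1,\dots,p_n$ in turn, where inserting $p_i$ gives the leaf centered at $T(p_i)$ a left child centered at $T(p_i)$ and a right child centered at $p_i$. Let $\mathrm{points}(v)$ be the set of points in the leaves below a node $v$; the radius of $v$ is the largest distance from its center to a point of $\mathrm{points}(v)$. A *greedy range tree* on $S$ with metrics $\mathsf d_1,\dots,\mathsf d_m$ is a greedy tree on $S$ with metric $\mathsf d_1$ (the primary tree) each node $v$ of which points, if $m>1$, to an auxiliary greedy range tree on $\mathrm{points}(v)$ with metrics $\mathsf d_2,\dots,\mathsf d_m$. A *range search* with radius $r$ in a greedy tree keeps a max-heap of nodes ordered by radius; a node $v$ is added (first the root) only if $\mathsf d(q,v)\le r+\mathrm{rad}(v)$. While the heap is not empty, a node $v$ of maximum radius is removed; if $\mathsf d(q,v)\le(1+\varepsilon)r-\mathrm{rad}(v)$ it is put out, otherwise it is replaced by those of its children that pass the first test. An *$m$-metric query* $(q,r_1,\dots,r_m,\varepsilon)$ descends level by level: the primary tree is searched with $(q,r_1)$ in $\mathsf d_1$,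 the auxiliary trees of all nodes put out are searched with $(q,r_2)$ in $\mathsf d_2$, and so on; the points below the nodes put out on level $m$ are reported. Time is the number of steps, where evaluating a metric, a real operation or comparison, and a pointer operation each take constant time, and the heap operations are counted in full. Then for every greedy range tree (with parameters $\alpha,\beta$) on $P$ with metrics $\mathsf d_1,\dots,\mathsf d_m$, every $q\in X$, all $r_1,\dots,r_m\ge 0$ and every $\varepsilon>0$: 1. The query reports a set of points (none twice), $\mathrm{output}$, with $$P\cap\bigcap_{i=1}^m \mathsf{ball}_{\mathsf d_i}(q,r_i)\subseteq\mathrm{output}\subseteq P\cap\bigcap_{i=1}^m\mathsf{ball}_{\mathsf d_i}(q,(1+\varepsilon)r_i).$$ 2. If $N_i$ is the number of nodes put out on level $i$, and $N_0=1$, then $N_i\le\left(2+\frac1\varepsilon\right)^{C\delta_i}N_{i-1}$ for $1\le i\le m$. 3. With $k=|\mathrm{output}|$, the query takes at most $$\left(2+\tfrac1\varepsilon\right)^{C\delta}\,(1+\log_2\Delta)+C\,k$$ steps, i.e. $(2+\frac1\varepsilon)^{O(\delta)}\log\Delta+O(k)$ steps when $\Delta\ge2$. -/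

import Mathlib

universe u

namespace GreedyRange

noncomputable section

/-! ## Finite metric spaces: doubling dimension and spread -/

/-- The doubling constant of the finite point set `S` under the distance `d`: the least `ρ` such
that every closed ball of `S` of radius `s` is covered by `ρ` closed balls of `S` of radius
`s / 2`. -/
def doublingConst {X : Type u} (d : X → X → ℝ) (S : Finset X) : ℕ :=
  sInf {ρ : ℕ | ∀ x ∈ S, ∀ s : ℝ, 0 < s → ∃ Z : Finset X, Z ⊆ S ∧ Z.card ≤ ρ ∧
    ∀ y ∈ S, d x y ≤ s → ∃ z ∈ Z, d z y ≤ s / 2}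

/-- The doubling dimension of `(S, d)`. -/
def doublingDim {X : Type u} (d : X → X → ℝ) (S : Finset X) : ℝ :=
  Real.logb 2 (doublingConst d S)

/-- The set of distances between distinct points of `S`. -/
def pairDists {X : Type u} (d : X → X → ℝ) (S : Finset X) : Set ℝ :=
  {a | ∃ x ∈ S, ∃ y ∈ S, x ≠ y ∧ a = d x y}

/-- The spread: largest pairwise distance divided by smallest pairwise distance. -/
def spread {X : Type u} (d : X → X → ℝ) (S : Finset X) : ℝ :=
  sSup (pairDists d S) / sInf (pairDists d S)

/-! ## Greedy permutations with predecessors -/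

/-- The distance from `x` to the prefix `{p 0, …, p (i - 1)}` (used for `0 < i`). -/
def distToPrefix {X : Type u} (d : X → X → ℝ) (p : ℕ → X) (i : ℕ) (x : X) : ℝ :=
  ⨅ k : Fin i, d x (p k)

/-- `p 0, …, p n` is a `β`-approximate greedy permutation of `S` (a greedy permutation for `β = 1`)
with an `α`-scaled, `β`-approximate predecessor map: `T i` is the index of the predecessor of
`p i`. -/
structure IsGreedyOrder {X : Type u} (α β : ℝ) (d : X → X → ℝ) (S : Set X) (n : ℕ)
    (p : ℕ → X) (T : ℕ → ℕ) : Prop where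
  bijOn : Set.BijOn p (Set.Iic n) S
  greedy : ∀ i, 0 < i → i ≤ n → ∀ j, i ≤ j → j ≤ n →
    distToPrefix d p i (p j) ≤ β * distToPrefix d p i (p i)
  pred_lt : ∀ i, 0 < i → i ≤ n → T i < i
  pred_near : ∀ i, 0 < i → i ≤ n → d (p i) (p (T i)) ≤ β * distToPrefix d p i (p i)
  scaled : ∀ i, 0 < i → i ≤ n → 0 < T i →
    α * d (p i) (p (T i)) ≤ d (p (T i)) (p (T (T i)))

/-! ## Ball trees and greedy trees -/

/-- The bare shape of a ball tree: every node knows its center, the points are in the leaves. -/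
inductive Shape (X : Type u) : Type u
  | leaf (center : X) : Shape X
  | node (center : X) (left right : Shape X) : Shape X

open Classical in
/-- Insert the point `x` with predecessor `a`: the leaf centered at `a` gets a left child centered
at `a` and a right child centered at `x`. -/
def Shape.insert {X : Type u} (x a : X) : Shape X → Shape X
  | .leaf c => if c = a then .node c (.leaf c) (.leaf x) else .leaf c
  | .node c l r => .node c (l.insert x a) (r.insert x a)

/-- The shape obtained by inserting `p 1, …, p n` one by one into the tree with the single
leaf `p 0`, the predecessor of `p i` being `p (T i)`. -/
def Shape.grow {X : Type u} (p : ℕ → X) (T : ℕ → ℕ) : ℕ → Shape X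
  | 0 => .leaf (p 0)
  | n + 1 => (Shape.grow p T n).insert (p (n + 1)) (p (T (n + 1)))

/-- A ball tree on `X`. Every node stores its center, its radius (zero at the leaves) and a pointer
to some further data of type `A`. -/
inductive BallTree (X A : Type u) : Type u
  | leaf (center : X) (aux : A) : BallTree X A
  | node (center : X) (radius : ℝ) (aux : A) (left right : BallTree X A) : BallTree X A

namespace BallTree

variable {X A : Type u}

def center : BallTree X A → X
  | leaf c _ => c
  | node c _ _ _ _ => c

def radius : BallTree X A → ℝ
  | leaf _ _ => 0
  | node _ s _ _ _ => s

def aux : BallTree X A → A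
  | leaf _ a => a
  | node _ _ a _ _ => a

/-- The points in the leaves. -/
def points : BallTree X A → List X
  | leaf c _ => [c]
  | node _ _ _ l r => l.points ++ r.points

/-- All nodes of the tree, each with the subtree below it. -/
def nodes : BallTree X A → List (BallTree X A)
  | leaf c a => [leaf c a]
  | node c s a l r => node c s a l r :: (l.nodes ++ r.nodes)

def shape : BallTree X A → Shape X
  | leaf c _ => .leaf c
  | node c _ _ l r => .node c l.shape r.shape

/-- The number of nodes. -/
def size : BallTree X A → ℕ
  | leaf _ _ => 1
  | node _ _ _ l r => l.size + r.size + 1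

end BallTree

/-- `t` is a greedy tree on `S` under the distance `d`: it is grown from a greedy permutation with
predecessors, and the radius of a node is the largest distance from its center to a point below
it. -/
def IsGreedyTree {X A : Type u} (α β : ℝ) (d : X → X → ℝ) (S : Set X) (t : BallTree X A) : Prop :=
  (∃ (n : ℕ) (p : ℕ → X) (T : ℕ → ℕ), IsGreedyOrder α β d S n p T ∧ t.shape = Shape.grow p T n) ∧
  ∀ v ∈ t.nodes, IsGreatest {a | ∃ x ∈ v.points, a = d v.center x} v.radius

/-! ## Greedy range trees -/

/-- Range trees with `m` levels: a ball tree each node of which points to an auxiliary range tree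
with one level less. -/
abbrev RangeTree (X : Type u) : ℕ → Type u
  | 0 => PUnit
  | m + 1 => BallTree X (RangeTree X m)

/-- `t` is a greedy range tree on `S` with the distances `d 0, …, d (m - 1)`: its primary tree is a
greedy tree on `S` under `d 0`, and each node `v` of it points to a greedy range tree on the points
of `v` with the remaining distances. -/
def IsGreedyRangeTree {X : Type u} (α β : ℝ) :
    (m : ℕ) → (Fin m → X → X → ℝ) → Set X → RangeTree X m → Prop
  | 0, _, _, _ => True
  | m + 1, d, S, t =>
      IsGreedyTree α β (d 0) S (A := RangeTree X m) t ∧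
      ∀ v ∈ BallTree.nodes (A := RangeTree X m) t,
        IsGreedyRangeTree α β m (fun i => d i.succ) {x | x ∈ v.points} v.aux

/-! ## Algorithms with a step count

An algorithm returns a value together with the number of steps it made. Every call of every
function below, recursive calls included, is charged at least one step, every evaluation of a
metric is charged one step, and apart from the calls it makes a function body does only a constant
number of real operations, comparisons and pointer operations. -/

/-- A value with the number of steps spent on computing it. -/
structure Timed (A : Type u) : Type u where
  val : A
  time : ℕ

/-- Leftist heaps with a maximum at the root (`rank` is the length of the right spine). -/
inductive Heap (B : Type u) : Type u
  | nil : Heap B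
  | node (rank : ℕ) (val : B) (left right : Heap B) : Heap B

namespace Heap

variable {B : Type u}

def rank : Heap B → ℕ
  | nil => 0
  | node k _ _ _ => k

/-- The sum of the values of `f` over the entries of the heap. -/
def weight (f : B → ℕ) : Heap B → ℕ
  | nil => 0
  | node _ v l r => f v + l.weight f + r.weight f

/-- Assemble a root and two heaps, the one of larger rank to the left. -/
def make (v : B) (a b : Heap B) : Heap B :=
  if b.rank ≤ a.rank then node (b.rank + 1) v a b else node (a.rank + 1) v b a

/-- Merge two heaps ordered by `key`, along their right spines. -/
def merge (key : B → ℝ) : Heap B → Heap B → Timed (Heap B)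
  | nil, h => ⟨h, 1⟩
  | node k v l r, nil => ⟨node k v l r, 1⟩
  | node k v l r, node k₂ v₂ l₂ r₂ =>
      if key v₂ ≤ key v then
        let h := merge key r (node k₂ v₂ l₂ r₂)
        ⟨make v l h.val, h.time + 1⟩
      else
        let h := merge key (node k v l r) r₂
        ⟨make v₂ l₂ h.val, h.time + 1⟩
termination_by g h => sizeOf g + sizeOf h

def push (key : B → ℝ) (v : B) (h : Heap B) : Timed (Heap B) :=
  let g := merge key (node 1 v nil nil) h
  ⟨g.val, g.time + 1⟩

theorem weight_make (f : B → ℕ) (v : B) (a b : Heap B) :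
    (make v a b).weight f = f v + a.weight f + b.weight f := by
  unfold make
  split
  · simp only [weight]
  · simp only [weight]; omega

theorem weight_merge (f : B → ℕ) (key : B → ℝ) (g h : Heap B) :
    (merge key g h).val.weight f = g.weight f + h.weight f := by
  fun_induction merge key g h with
  | case1 h => simp [weight]
  | case2 k v l r => simp [weight]
  | case3 k v l r k₂ v₂ l₂ r₂ hk h ih =>
    simp only [weight_make, ih, h, weight]; omega
  | case4 k v l r k₂ v₂ l₂ r₂ hk h ih =>
    simp only [weight_make, ih, h, weight]; omega

theorem weight_push (f : B → ℕ) (key : B → ℝ) (v : B) (h : Heap B) :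
    (push key v h).val.weight f = f v + h.weight f := by
  simp [push, weight_merge, weight]

end Heap

section Search

variable {X A : Type u}

/-- Add the node `v` to the heap if its ball can meet the ball of radius `r` around `q`. -/
def pushViable (d : X → X → ℝ) (q : X) (r : ℝ) (v : BallTree X A) (H : Heap (BallTree X A)) :
    Timed (Heap (BallTree X A)) :=
  if d q v.center ≤ r + v.radius then
    let G := Heap.push BallTree.radius v H
    ⟨G.val, G.time + 2⟩
  else ⟨H, 2⟩

theorem weight_pushViable (d : X → X → ℝ) (q : X) (r : ℝ) (v : BallTree X A)
    (H : Heap (BallTree X A)) :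
    (pushViable d q r v H).val.weight BallTree.size ≤ v.size + H.weight BallTree.size := by
  unfold pushViable
  split
  · simp [Heap.weight_push]
  · simp

/-- The main loop of a range search, with heap `H` and the nodes `out` found so far: a node `v` of
maximum radius is removed from the heap; if its ball lies in the ball of radius `(1 + ε) * r` around
`q` then `v` is put out, otherwise it is split into its children, and those that can meet the
ball of radius `r` are added to the heap. -/
def searchLoop (d : X → X → ℝ) (q : X) (r ε : ℝ) (H : Heap (BallTree X A))
    (out : List (BallTree X A)) : Timed (List (BallTree X A)) :=
  match H with
  | .nil => ⟨out, 1⟩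
  | .node _ v L R =>
      let H₀ := Heap.merge BallTree.radius L R
      if d q v.center ≤ (1 + ε) * r - v.radius then
        let res := searchLoop d q r ε H₀.val (v :: out)
        ⟨res.val, res.time + H₀.time + 2⟩
      else
        match v with
        | .leaf _ _ =>
            let res := searchLoop d q r ε H₀.val out
            ⟨res.val, res.time + H₀.time + 2⟩
        | .node _ _ _ vL vR =>
            let H₁ := pushViable d q r vR H₀.val
            let H₂ := pushViable d q r vL H₁.val
            let res := searchLoop d q r ε H₂.val out
            ⟨res.val, res.time + H₀.time + H₁.time + H₂.time + 2⟩
termination_by H.weight BallTree.size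
decreasing_by
  · have hv : 0 < v.size := by cases v <;> simp [BallTree.size]
    simp only [Heap.weight_merge, Heap.weight]
    omega
  · simp only [Heap.weight_merge, Heap.weight, BallTree.size]
    omega
  · have h₁ := weight_pushViable d q r vR (Heap.merge BallTree.radius L R).val
    have h₂ := weight_pushViable d q r vL
      (pushViable d q r vR (Heap.merge BallTree.radius L R).val).val
    simp only [Heap.weight_merge] at h₁
    simp only [Heap.weight, BallTree.size]
    omega

/-- Range search in a ball tree; the nodes found are put in front of the list `out`. -/
def rangeSearch (d : X → X → ℝ) (q : X) (r ε : ℝ) (t : BallTree X A)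
    (out : List (BallTree X A)) : Timed (List (BallTree X A)) :=
  let H := pushViable d q r t .nil
  let res := searchLoop d q r ε H.val out
  ⟨res.val, res.time + H.time + 1⟩

/-- Range search in each tree of a list; the nodes found are put in front of the list `out`. -/
def searchAll (d : X → X → ℝ) (q : X) (r ε : ℝ) :
    List (BallTree X A) → List (BallTree X A) → Timed (List (BallTree X A))
  | [], out => ⟨out, 1⟩
  | t :: ts, out =>
      let a := rangeSearch d q r ε t out
      let b := searchAll d q r ε ts a.val
      ⟨b.val, a.time + b.time + 1⟩

/-- Follow the auxiliary pointers of a list of nodes. -/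
def followAux : List (BallTree X A) → Timed (List A)
  | [] => ⟨[], 1⟩
  | v :: vs =>
      let a := followAux vs
      ⟨v.aux :: a.val, a.time + 1⟩

/-- Report the points of a tree, in front of the list `acc`. -/
def report : BallTree X A → List X → Timed (List X)
  | .leaf c _, acc => ⟨c :: acc, 1⟩
  | .node _ _ _ l r, acc =>
      let a := report r acc
      let b := report l a.val
      ⟨b.val, a.time + b.time + 1⟩

/-- Report the points of all trees in a list. -/
def reportAll : List (BallTree X A) → Timed (List X)
  | [] => ⟨[], 1⟩
  | v :: vs =>
      let a := reportAll vs
      let b := report v a.val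
      ⟨b.val, a.time + b.time + 1⟩

end Search

/-- The result of an `m`-metric query: the points put out, the number of steps, and for each level
the number of nodes in the collection found on that level (kept for the analysis only). -/
structure QueryResult (X : Type u) (m : ℕ) : Type u where
  output : List X
  time : ℕ
  count : Fin m → ℕ

/-- The query, level by level, for a collection of range trees with `m + 1` levels: all primary
trees are searched in the first metric, then the auxiliary trees of the nodes found are queried in
the remaining metrics; on the last level the points of the nodes found are reported. -/
def queryAll {X : Type u} (q : X) (ε : ℝ) : (m : ℕ) → (Fin (m + 1) → X → X → ℝ) →
    (Fin (m + 1) → ℝ) → List (RangeTree X (m + 1)) → QueryResult X (m + 1)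
  | 0, d, r, ts =>
      let a := searchAll (A := RangeTree X 0) (d 0) q (r 0) ε ts []
      let b := reportAll a.val
      ⟨b.val, a.time + b.time + 1, fun _ => a.val.length⟩
  | m + 1, d, r, ts =>
      let a := searchAll (A := RangeTree X (m + 1)) (d 0) q (r 0) ε ts []
      let b := followAux a.val
      let c := queryAll q ε m (fun i => d i.succ) (fun i => r i.succ) b.val
      ⟨c.output, a.time + b.time + c.time + 1, Fin.cons a.val.length c.count⟩

/-- The approximate product range query `(q, r 0, …, r m, ε)` in the range tree `t`. -/
def query {X : Type u} {m : ℕ} (d : Fin (m + 1) → X → X → ℝ) (t : RangeTree X (m + 1)) (q : X)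
    (r : Fin (m + 1) → ℝ) (ε : ℝ) : QueryResult X (m + 1) :=
  queryAll q ε m d r [t]

end

end GreedyRange

/-! Give each point `p i` with `i > 0` its insertion distance, the distance to the earlier points,
as a weight, and give `p 0` a weight as large as desired. The later of two points keeps its weight
as distance from the earlier one, so points of weight above `σ` are more than `σ` apart. By iterated
doubling, at most `ρ ^ k` of them have distance at most `D` from a given point, once `4 * D ≤ 2 ^ k
* σ` (`card_le_of_separated`, `Packed.card_le`). On the other hand, the inner node created by
inserting `p i` has radius at most a constant times the insertion distance of `p i`: steps to
predecessors shrink by the factor `α` along a chain, so they sum geometrically. Since insertion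
distances decrease up to the factor `β`, the radius is at most `K = α * β ^ 3 / (α - 1)` times the
weight of the center of either child (`exists_packed`).

A search splits a node of radius `s` only if its ball may meet the small ball and is not known to
lie in the large one; this forces `ε * r < 2 * s`, so relevant radii are not small compared with
`r`. With `2 ^ k` of order `K * (2 + 1 / ε)` and `N = ρ ^ k`, packing then bounds three quantities
by `N`: the size of the heap, because nodes leave it by decreasing radius (`Frontier.split`,
`Frontier.card_le`); the number of nodes put out (`Found.length_le`); and the number of splits at
one dyadic scale of radii (`Packed.splitCount_le`). There are about `log Δ` scales, and a heap
operation is charged the whole heap size, so one search costs `O(N ^ 2 * log Δ)`; the square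
disappears in the exponent.

Each level multiplies the number of trees by at most `N ≥ 2`, so the costs of the levels form a
geometric sum, without a factor for the number of levels. Nodes put out have disjoint point sets and
a binary tree has fewer than twice as many nodes as leaves, so reporting is linear in the output.
Finally `ρ ^ k = (2 ^ k) ^ δ`, and `δ ≥ 1` lets constant factors be absorbed into the exponent. -/

namespace GreedyRange

/-- `d` is a metric, as an unbundled property. -/
structure IsMetric {X : Type u} (d : X → X → ℝ) : Prop where
  self : ∀ x, d x x = 0
  comm : ∀ x y, d x y = d y x
  triangle : ∀ x y z, d x z ≤ d x y + d y z
  pos : ∀ x y, x ≠ y → 0 < d x y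

theorem IsMetric.nonneg {X : Type u} {d : X → X → ℝ} (hd : IsMetric d) (x y : X) : 0 ≤ d x y := by
  by_cases h : x = y
  · rw [h, hd.self]
  · exact (hd.pos x y h).le

theorem isMetric_dist {X : Type u} (M : MetricSpace X) : IsMetric M.dist where
  self := M.dist_self
  comm := M.dist_comm
  triangle := M.dist_triangle
  pos := fun x y h => lt_of_le_of_ne (@dist_nonneg X _ x y) fun h0 => h (M.eq_of_dist_eq_zero h0.symm)

/-! ## Doubling and packing -/

section Packing

variable {X : Type u} {d : X → X → ℝ} {P : Finset X}

theorem doublingConst_spec (hd : IsMetric d) : ∀ x ∈ P, ∀ s : ℝ, 0 < s → ∃ Z : Finset X, Z ⊆ P ∧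
    Z.card ≤ doublingConst d P ∧ ∀ y ∈ P, d x y ≤ s → ∃ z ∈ Z, d z y ≤ s / 2 := by
  refine Nat.sInf_mem (s := {ρ : ℕ | ∀ x ∈ P, ∀ s : ℝ, 0 < s → ∃ Z : Finset X, Z ⊆ P ∧ Z.card ≤ ρ ∧
    ∀ y ∈ P, d x y ≤ s → ∃ z ∈ Z, d z y ≤ s / 2}) ⟨P.card, fun x _ s hs =>
      ⟨P, subset_rfl, le_rfl, fun y hy _ => ⟨y, hy, ?_⟩⟩⟩
  rw [hd.self]; positivity

theorem exists_cover (hd : IsMetric d) {D : ℝ} (hD : 0 < D) {c : X} (hc : c ∈ P) (k : ℕ) :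
    ∃ Z : Finset X, Z ⊆ P ∧ Z.card ≤ doublingConst d P ^ k ∧
      ∀ y ∈ P, d c y ≤ D → ∃ z ∈ Z, d z y ≤ D / 2 ^ k := by
  classical
  induction k with
  | zero => exact ⟨{c}, by simpa using hc, by simp, fun y _ h => ⟨c, by simp, by simpa using h⟩⟩
  | succ k ih =>
    obtain ⟨Z, hZP, hZc, hZ⟩ := ih
    have hpos : (0 : ℝ) < D / 2 ^ k := by positivity
    choose! W hWP hWc hW using fun x hx => doublingConst_spec hd (P := P) x hx (D / 2 ^ k) hpos
    refine ⟨Z.biUnion W, Finset.biUnion_subset.2 fun z hz => hWP z (hZP hz), ?_, fun y hy h => ?_⟩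
    · rw [pow_succ]
      exact (Finset.card_biUnion_le_card_mul _ _ _ fun z hz => hWc z (hZP hz)).trans
        (Nat.mul_le_mul_right _ hZc)
    · obtain ⟨z, hz, hzy⟩ := hZ y hy h
      obtain ⟨w, hw, hwy⟩ := hW z (hZP hz) y hy hzy
      refine ⟨w, Finset.mem_biUnion.2 ⟨z, hz, hw⟩, hwy.trans_eq ?_⟩
      rw [pow_succ, div_div]

/-- Around a closest pair, at distance `a`, balls of radius `a / 2` are singletons, so covering the
ball of radius `a` takes both points as centers. This gives `δ ≥ 1`, which later absorbs constants.
-/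
theorem two_le_doublingConst (hd : IsMetric d) (hP : P.Nontrivial) : 2 ≤ doublingConst d P := by
  classical
  obtain ⟨x₀, hx₀, y₀, hy₀, hne₀⟩ := hP
  obtain ⟨⟨x, y⟩, hxy, hmin⟩ := P.offDiag.exists_min_image (fun z => d z.1 z.2)
    ⟨(x₀, y₀), Finset.mem_offDiag.2 ⟨hx₀, hy₀, hne₀⟩⟩
  rw [Finset.mem_offDiag] at hxy
  obtain ⟨hx, hy, hne⟩ := hxy
  have hpos := hd.pos x y hne
  obtain ⟨Z, hZP, hZc, hZ⟩ := doublingConst_spec hd x hx _ hpos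
  have key : ∀ w ∈ P, d x w ≤ d x y → w ∈ Z := by
    intro w hw h
    obtain ⟨z, hz, hzw⟩ := hZ w hw h
    by_cases hzw' : z = w
    · exact hzw' ▸ hz
    · have := hmin (z, w) (Finset.mem_offDiag.2 ⟨hZP hz, hw, hzw'⟩)
      dsimp only at this
      linarith
  have hsub : ({x, y} : Finset X) ⊆ Z := by
    intro w hw
    simp only [Finset.mem_insert, Finset.mem_singleton] at hw
    rcases hw with rfl | rfl
    · exact key _ hx (by rw [hd.self]; exact hpos.le)
    · exact key _ hy le_rfl
  calc 2 = ({x, y} : Finset X).card := (Finset.card_pair hne).symm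
    _ ≤ Z.card := Finset.card_le_card hsub
    _ ≤ _ := hZc

/-- Well separated points of bounded diameter are few. -/
theorem card_le_of_separated (hd : IsMetric d) (hP : P.Nontrivial) {Q : Finset X} (hQ : Q ⊆ P)
    {D : ℝ} {k : ℕ} (hdiam : ∀ x ∈ Q, ∀ y ∈ Q, d x y ≤ D)
    (hsep : ∀ x ∈ Q, ∀ y ∈ Q, x ≠ y → 2 * D < 2 ^ k * d x y) :
    Q.card ≤ doublingConst d P ^ k := by
  classical
  have hone : 1 ≤ doublingConst d P ^ k :=
    Nat.one_le_pow _ _ (by have := two_le_doublingConst hd hP; omega)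
  rcases Q.eq_empty_or_nonempty with rfl | ⟨c, hc⟩
  · simp
  have hD0 : 0 ≤ D := (hd.nonneg c c).trans (hdiam c hc c hc)
  rcases hD0.eq_or_lt with rfl | hD
  · refine le_trans (Finset.card_le_one.2 fun x hx y hy => ?_) hone
    by_contra h
    exact absurd (hdiam x hx y hy) (not_le.2 (hd.pos x y h))
  obtain ⟨Z, hZP, hZc, hZ⟩ := exists_cover hd hD (hQ hc) k
  choose! f hfZ hf using fun y (hy : y ∈ Q) => hZ y (hQ hy) (hdiam c hc y hy)
  -- Each covering ball has radius `D / 2 ^ k`, hence contains at most one point of `Q`.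
  refine le_trans (Finset.card_le_card_of_injOn f hfZ fun x hx y hy hxy => ?_) hZc
  by_contra hne
  have h1 := hf x hx
  have h2 := hf y hy
  have h3 := hd.triangle x (f x) y
  rw [hd.comm x (f x)] at h3
  rw [← hxy] at h2
  have h4 := hsep x hx y hy hne
  have h5 : d x y ≤ 2 * (D / 2 ^ k) := by linarith
  have h6 : (2 : ℝ) ^ k * d x y ≤ 2 ^ k * (2 * (D / 2 ^ k)) := by gcongr
  have h7 : (2 : ℝ) ^ k * (2 * (D / 2 ^ k)) = 2 * D := by field_simp
  linarith

theorem pairDists_finite : (pairDists d P).Finite := by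
  refine ((P ×ˢ P).finite_toSet.image fun z => d z.1 z.2).subset ?_
  rintro a ⟨x, hx, y, hy, -, rfl⟩
  exact ⟨(x, y), by simp [hx, hy], rfl⟩

theorem sInf_pairDists_pos (hd : IsMetric d) (hP : P.Nontrivial) : 0 < sInf (pairDists d P) := by
  obtain ⟨x₀, hx₀, y₀, hy₀, hne₀⟩ := hP
  obtain ⟨x, hx, y, hy, hne, h⟩ := Set.Nonempty.csInf_mem
    (s := pairDists d P) ⟨_, x₀, hx₀, y₀, hy₀, hne₀, rfl⟩ pairDists_finite
  rw [h]; exact hd.pos x y hne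

theorem sInf_pairDists_le {x y : X} (hx : x ∈ P) (hy : y ∈ P) (h : x ≠ y) :
    sInf (pairDists d P) ≤ d x y :=
  csInf_le pairDists_finite.bddBelow ⟨x, hx, y, hy, h, rfl⟩

theorem le_sSup_pairDists {x y : X} (hx : x ∈ P) (hy : y ∈ P) (h : x ≠ y) :
    d x y ≤ sSup (pairDists d P) :=
  le_csSup pairDists_finite.bddAbove ⟨x, hx, y, hy, h, rfl⟩

theorem one_le_spread (hd : IsMetric d) (hP : P.Nontrivial) : 1 ≤ spread d P := by
  have h0 := sInf_pairDists_pos hd hP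
  obtain ⟨x, hx, y, hy, hne⟩ := hP
  rw [spread, one_le_div h0]
  exact (sInf_pairDists_le hx hy hne).trans (le_sSup_pairDists hx hy hne)

/-- Distances in a finite metric space fall into few dyadic scales. -/
theorem floor_logb_lt (hd : IsMetric d) (hP : P.Nontrivial) {x y : X} (hx : x ∈ P) (hy : y ∈ P)
    (h : x ≠ y) : ⌊Real.logb 2 (d x y / sInf (pairDists d P))⌋₊ <
      ⌊Real.logb 2 (spread d P)⌋₊ + 1 := by
  have h0 := sInf_pairDists_pos hd hP
  have h1 := hd.pos x y h
  refine Nat.lt_succ_of_le (Nat.floor_le_floor ?_)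
  refine Real.logb_le_logb_of_le (by norm_num) (by positivity) ?_
  exact div_le_div_of_nonneg_right (le_sSup_pairDists hx hy h) h0.le

end Packing

end GreedyRange

namespace GreedyRange

/-! ## The structure of greedy trees -/

namespace Shape

variable {X : Type u}

def center : Shape X → X
  | leaf c => c
  | node c _ _ => c

def points : Shape X → List X
  | leaf c => [c]
  | node _ l r => l.points ++ r.points

@[simp] theorem center_insert (x a : X) (s : Shape X) : (s.insert x a).center = s.center := by
  cases s with
  | leaf c => unfold insert; split <;> rfl
  | node c l r => rfl

theorem mem_points_insert {x a y : X} {s : Shape X} :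
    y ∈ (s.insert x a).points ↔ y ∈ s.points ∨ (y = x ∧ a ∈ s.points) := by
  induction s with
  | leaf c =>
    unfold insert
    split
    · next h => simp [points, h]
    · next h => simp [points, Ne.symm h]
  | node c l r ihl ihr =>
    simp only [insert, points, List.mem_append, ihl, ihr]
    tauto

theorem nodup_points_insert {x a : X} {s : Shape X} (hs : s.points.Nodup) (hx : x ∉ s.points) :
    (s.insert x a).points.Nodup := by
  induction s with
  | leaf c =>
    unfold insert
    split
    · simpa [points, eq_comm] using hx
    · simp [points]
  | node c l r ihl ihr =>
    simp only [points, List.mem_append, not_or, List.nodup_append'] at hs hx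
    simp only [insert, points, List.nodup_append']
    refine ⟨ihl hs.1 hx.1, ihr hs.2.1 hx.2, fun y hl hr => ?_⟩
    rw [mem_points_insert] at hl hr
    rcases hl with hl | ⟨rfl, hl⟩ <;> rcases hr with hr | ⟨h, hr⟩
    · exact hs.2.2 hl hr
    · exact hx.1 (h ▸ hl)
    · exact hx.2 hr
    · exact hs.2.2 hl hr

/-- Every inner node of the shape is the effect of inserting some `p i` with `0 < i ≤ n`, and the
points below it, apart from its center, are inserted not before `p i` and satisfy `B i`. -/
def Grown (p : ℕ → X) (T : ℕ → ℕ) (B : ℕ → X → ℕ → Prop) (n : ℕ) : Shape X → Prop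
  | leaf _ => True
  | node c l r => l.center = c ∧ (∃ i, 0 < i ∧ i ≤ n ∧ r.center = p i ∧ c = p (T i) ∧
      ∀ x, x ∈ l.points ∨ x ∈ r.points → x ≠ c → ∃ j, i ≤ j ∧ j ≤ n ∧ x = p j ∧ B i c j) ∧
      l.Grown p T B n ∧ r.Grown p T B n

/-- A new point lands below an existing inner node only if its predecessor does. Either the
predecessor is the center of that node (`hself`), or it is another point there and its bound is
passed on (`hstep`). Injectivity (`hinj`) ensures that the index known for the predecessor is `T (n
+ 1)`. -/
theorem Grown.insert {p : ℕ → X} {T : ℕ → ℕ} {B : ℕ → X → ℕ → Prop} {n : ℕ}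
    (hself : ∀ i, 0 < i → i ≤ n + 1 → B i (p (T (n + 1))) (n + 1))
    (hinj : ∀ i ≤ n, p i = p (T (n + 1)) → i = T (n + 1))
    (hstep : ∀ i c, 0 < i → i ≤ T (n + 1) → i ≤ n → B i c (T (n + 1)) → B i c (n + 1))
    {s : Shape X} (hs : s.Grown p T B n) :
    (s.insert (p (n + 1)) (p (T (n + 1)))).Grown p T B (n + 1) := by
  induction s with
  | leaf c =>
    unfold Shape.insert
    split
    · next h =>
      refine ⟨rfl, ⟨n + 1, n.succ_pos, le_rfl, rfl, h, fun x hx hxc => ?_⟩, trivial, trivial⟩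
      simp only [points, List.mem_singleton] at hx
      rcases hx with rfl | rfl
      · exact absurd rfl hxc
      · exact ⟨n + 1, le_rfl, le_rfl, rfl, h ▸ hself _ n.succ_pos le_rfl⟩
    · trivial
  | node c l r ihl ihr =>
    obtain ⟨hc, ⟨i, hi0, hin, hr, hci, hB⟩, hl, hr'⟩ := hs
    refine ⟨by simpa using hc, ⟨i, hi0, by omega, by simpa using hr, hci, fun x hx hxc => ?_⟩,
      ihl hl, ihr hr'⟩
    simp only [mem_points_insert] at hx
    have hx' : (x ∈ l.points ∨ x ∈ r.points) ∨
        (x = p (n + 1) ∧ (p (T (n + 1)) ∈ l.points ∨ p (T (n + 1)) ∈ r.points)) := by tauto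
    rcases hx' with hx | ⟨rfl, hT⟩
    · obtain ⟨j, h1, h2, h3, h4⟩ := hB x hx hxc
      exact ⟨j, h1, by omega, h3, h4⟩
    · refine ⟨n + 1, by omega, le_rfl, rfl, ?_⟩
      by_cases hTc : p (T (n + 1)) = c
      · exact hTc ▸ hself i hi0 (by omega)
      · obtain ⟨j, h1, h2, h3, h4⟩ := hB _ hT hTc
        obtain rfl := hinj j h2 h3.symm
        exact hstep i c hi0 h1 hin h4

theorem center_grow (p : ℕ → X) (T : ℕ → ℕ) (n : ℕ) : (grow p T n).center = p 0 := by
  induction n with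
  | zero => rfl
  | succ n ih => simpa [grow] using ih

theorem mem_points_grow {p : ℕ → X} {T : ℕ → ℕ} {n : ℕ} (hT : ∀ i, 0 < i → i ≤ n → T i < i)
    {x : X} : x ∈ (grow p T n).points ↔ ∃ i ≤ n, x = p i := by
  induction n generalizing x with
  | zero => simp [grow, points]
  | succ n ih =>
    have ih' := fun y => ih (fun i h0 h1 => hT i h0 (by omega)) (x := y)
    rw [grow, mem_points_insert, ih', ih']
    have hlt := hT (n + 1) n.succ_pos le_rfl
    constructor
    · rintro (⟨i, hi, rfl⟩ | ⟨rfl, -⟩)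
      · exact ⟨i, by omega, rfl⟩
      · exact ⟨_, le_rfl, rfl⟩
    · rintro ⟨i, hi, rfl⟩
      rcases hi.eq_or_lt with rfl | hi
      · exact .inr ⟨rfl, _, by omega, rfl⟩
      · exact .inl ⟨i, by omega, rfl⟩

theorem nodup_points_grow {p : ℕ → X} {T : ℕ → ℕ} {n : ℕ} (hp : Set.InjOn p (Set.Iic n))
    (hT : ∀ i, 0 < i → i ≤ n → T i < i) : (grow p T n).points.Nodup := by
  induction n with
  | zero => simp [grow, points]
  | succ n ih =>
    refine nodup_points_insert (ih (hp.mono (Set.Iic_subset_Iic.2 n.le_succ))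
      fun i h0 h1 => hT i h0 (by omega)) fun h => ?_
    obtain ⟨i, hi, h⟩ := (mem_points_grow fun i h0 h1 => hT i h0 (by omega)).1 h
    have := hp (Set.mem_Iic.2 le_rfl) (Set.mem_Iic.2 (by omega : i ≤ n + 1)) h
    omega

end Shape

/-! ### Insertion distances -/

section Order

variable {X : Type u} {d : X → X → ℝ} {α β : ℝ} {S : Set X} {n : ℕ} {p : ℕ → X} {T : ℕ → ℕ}

theorem distToPrefix_le (hd : IsMetric d) {i k : ℕ} (hk : k < i) (x : X) :
    distToPrefix d p i x ≤ d x (p k) :=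
  ciInf_le (f := fun k : Fin i => d x (p k)) ⟨0, by rintro _ ⟨k, rfl⟩; exact hd.nonneg _ _⟩ ⟨k, hk⟩

theorem distToPrefix_nonneg (hd : IsMetric d) (i : ℕ) (x : X) : 0 ≤ distToPrefix d p i x :=
  Real.iInf_nonneg fun _ => hd.nonneg _ _

theorem distToPrefix_anti (hd : IsMetric d) {i j : ℕ} (hi : 0 < i) (hij : i ≤ j) (x : X) :
    distToPrefix d p j x ≤ distToPrefix d p i x :=
  -- Over an empty prefix the real infimum is the default value 0, and monotonicity would fail.
  haveI : Nonempty (Fin i) := ⟨⟨0, hi⟩⟩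
  le_ciInf fun k => distToPrefix_le hd (k.2.trans_le hij) x

namespace IsGreedyOrder

/-- Insertion distances decrease, up to the factor `β`. -/
theorem insertion_le (h : IsGreedyOrder α β d S n p T) (hd : IsMetric d) {i j : ℕ} (hi : 0 < i)
    (hij : i ≤ j) (hj : j ≤ n) : distToPrefix d p j (p j) ≤ β * distToPrefix d p i (p i) :=
  (distToPrefix_anti hd hi hij _).trans (h.greedy i hi (hij.trans hj) j hij hj)

theorem dist_pred_le (h : IsGreedyOrder α β d S n p T) (hd : IsMetric d) (hβ : 1 ≤ β) {i j : ℕ}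
    (hi : 0 < i) (hij : i ≤ j) (hj : j ≤ n) :
    d (p j) (p (T j)) ≤ β ^ 2 * distToPrefix d p i (p i) := by
  refine (h.pred_near j (by omega) hj).trans ?_
  rw [pow_two, mul_assoc]
  exact mul_le_mul_of_nonneg_left (h.insertion_le hd hi hij hj) (by linarith)

/-- The term `1 / (α - 1) * d (p j) (p (T j))` is the reserve for all further steps of a chain of
successors of `p j`: these shrink by the factor `α`, and `1 / (α - 1)` is the sum of the powers of
`1 / α` from the first on. Thus the bound reproduces itself from the predecessor to the new point,
and the geometric series never appears. -/
theorem grown (h : IsGreedyOrder α β d S n p T) (hd : IsMetric d) (hα : 1 < α) (hβ : 1 ≤ β) :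
    (Shape.grow p T n).Grown p T (fun i c j => d c (p j) + 1 / (α - 1) * d (p j) (p (T j)) ≤
      α / (α - 1) * (β ^ 2 * distToPrefix d p i (p i))) n := by
  have hα' : 0 < α - 1 := by linarith
  have hsum : 1 + 1 / (α - 1) = α / (α - 1) := by field_simp; ring
  suffices ∀ k ≤ n, (Shape.grow p T k).Grown p T (fun i c j =>
      j ≤ n → d c (p j) + 1 / (α - 1) * d (p j) (p (T j)) ≤
      α / (α - 1) * (β ^ 2 * distToPrefix d p i (p i))) k by
    have key : ∀ s : Shape X, s.Grown p T (fun i c j =>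
      j ≤ n → d c (p j) + 1 / (α - 1) * d (p j) (p (T j)) ≤
      α / (α - 1) * (β ^ 2 * distToPrefix d p i (p i))) n → s.Grown p T (fun i c j =>
        d c (p j) + 1 / (α - 1) * d (p j) (p (T j)) ≤
        α / (α - 1) * (β ^ 2 * distToPrefix d p i (p i))) n := by
      intro s hs
      induction s with
      | leaf => trivial
      | node c l r ihl ihr =>
        obtain ⟨h1, ⟨i, h2, h3, h4, h5, h6⟩, h7, h8⟩ := hs
        refine ⟨h1, ⟨i, h2, h3, h4, h5, fun x hx hc => ?_⟩, ihl h7, ihr h8⟩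
        obtain ⟨j, h9, h10, h11, h12⟩ := h6 x hx hc
        exact ⟨j, h9, h10, h11, h12 h10⟩
    exact key _ (this n le_rfl)
  intro k hk
  induction k with
  | zero => trivial
  | succ k ih =>
    have hTlt := h.pred_lt (k + 1) k.succ_pos hk
    refine Shape.Grown.insert (fun i hi hik hkn => ?_) (fun i hi hp => ?_)
      (fun i c hi hiT hik hB hkn => ?_) (ih (by omega))
    · have h1 := h.dist_pred_le hd hβ hi hik hkn
      rw [hd.comm (p (T (k + 1)))]
      calc _ = α / (α - 1) * d (p (k + 1)) (p (T (k + 1))) := by rw [← hsum]; ring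
        _ ≤ _ := mul_le_mul_of_nonneg_left h1 (by positivity)
    · exact h.bijOn.injOn (Set.mem_Iic.2 (by omega)) (Set.mem_Iic.2 (by omega)) hp
    · have h1 := hB (by omega)
      -- The scaling condition applies because the predecessor has index at least `i > 0`.
      have h2 := h.scaled (k + 1) k.succ_pos hk (by omega)
      have h3 := hd.triangle c (p (T (k + 1))) (p (k + 1))
      rw [hd.comm (p (T (k + 1))) (p (k + 1))] at h3
      have h4 : 1 / (α - 1) * (α * d (p (k + 1)) (p (T (k + 1)))) ≤
          1 / (α - 1) * d (p (T (k + 1))) (p (T (T (k + 1)))) :=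
        mul_le_mul_of_nonneg_left h2 (by positivity)
      have h5 : 1 / (α - 1) * (α * d (p (k + 1)) (p (T (k + 1)))) =
          d (p (k + 1)) (p (T (k + 1))) + 1 / (α - 1) * d (p (k + 1)) (p (T (k + 1))) := by
        field_simp; ring
      linarith

end IsGreedyOrder

end Order

/-! ### Ball trees -/

namespace BallTree

variable {X A : Type u}

theorem center_shape (t : BallTree X A) : t.shape.center = t.center := by cases t <;> rfl

theorem points_shape (t : BallTree X A) : t.shape.points = t.points := by
  induction t with
  | leaf => rfl
  | node c s a l r ihl ihr => simp [shape, Shape.points, points, ihl, ihr]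

theorem mem_nodes_self (t : BallTree X A) : t ∈ t.nodes := by cases t <;> simp [nodes]

theorem nodes_subset {t v : BallTree X A} (h : v ∈ t.nodes) : v.nodes ⊆ t.nodes := by
  induction t with
  | leaf => simp only [nodes, List.mem_singleton] at h; simp [h]
  | node c s a l r ihl ihr =>
    simp only [nodes, List.mem_cons, List.mem_append] at h
    rcases h with rfl | h | h
    · exact List.Subset.refl _
    · exact fun w hw => by simp [nodes, ihl h hw]
    · exact fun w hw => by simp [nodes, ihr h hw]

theorem points_sublist {t v : BallTree X A} (h : v ∈ t.nodes) : v.points.Sublist t.points := by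
  induction t with
  | leaf => simp only [nodes, List.mem_singleton] at h; simp [h]
  | node c s a l r ihl ihr =>
    simp only [nodes, List.mem_cons, List.mem_append] at h
    rcases h with rfl | h | h
    · exact List.Sublist.refl _
    · exact (ihl h).trans (List.sublist_append_left _ _)
    · exact (ihr h).trans (List.sublist_append_right _ _)

theorem grown_shape {p : ℕ → X} {T : ℕ → ℕ} {B : ℕ → X → ℕ → Prop} {n : ℕ} {t v : BallTree X A}
    (h : v ∈ t.nodes) (ht : t.shape.Grown p T B n) : v.shape.Grown p T B n := by
  induction t with
  | leaf => simp only [nodes, List.mem_singleton] at h; simpa [h] using ht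
  | node c s a l r ihl ihr =>
    simp only [nodes, List.mem_cons, List.mem_append] at h
    rcases h with rfl | h | h
    · exact ht
    · exact ihl h ht.2.2.1
    · exact ihr h ht.2.2.2

/-- The ball tree has correct radii and pairwise distinct points, each node and its left child have
the same center, and the weights `lam` of the points bound their mutual distances from below and
the radii of the parents of the nodes from above. -/
structure Packed (d : X → X → ℝ) (K : ℝ) (lam : X → ℝ) (t : BallTree X A) : Prop where
  nodup : t.points.Nodup
  sep : ∀ x ∈ t.points, ∀ y ∈ t.points, x ≠ y → min (lam x) (lam y) ≤ d x y
  greatest : ∀ v ∈ t.nodes, IsGreatest {a | ∃ x ∈ v.points, a = d v.center x} v.radius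
  center_left : ∀ c s a l r, node c s a l r ∈ t.nodes → l.center = c
  le_left : ∀ c s a l r, node c s a l r ∈ t.nodes → s ≤ K * lam l.center
  le_right : ∀ c s a l r, node c s a l r ∈ t.nodes → s ≤ K * lam r.center

end BallTree

namespace IsGreedyTree

variable {X A : Type u} {d : X → X → ℝ} {α β : ℝ} {S : Set X} {t : BallTree X A}

theorem mem_points_iff (h : IsGreedyTree α β d S t) {x : X} : x ∈ t.points ↔ x ∈ S := by
  obtain ⟨⟨n, p, T, ho, hs⟩, -⟩ := h
  rw [← BallTree.points_shape, hs, Shape.mem_points_grow ho.pred_lt, ← ho.bijOn.image_eq]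
  simp [eq_comm]

/-- The weights are the insertion distances. The first point has none, and separation only sees the
smaller of two weights, so its weight is free; `L` lets a search start with a root that is heavy
compared with `r`. -/
theorem exists_packed (h : IsGreedyTree α β d S t) (hd : IsMetric d) (hα : 1 < α) (hβ : 1 ≤ β)
    (L : ℝ) : ∃ lam : X → ℝ,
      L ≤ lam t.center ∧ t.Packed d (α * β ^ 3 / (α - 1)) lam := by
  classical
  obtain ⟨⟨n, p, T, ho, hs⟩, hrad⟩ := h
  have hα' : 0 < α - 1 := by linarith
  set e : ℕ → ℝ := fun i => distToPrefix d p i (p i) with he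
  have he0 : ∀ i, 0 ≤ e i := fun i => distToPrefix_nonneg hd _ _
  -- The sum is a convenient upper bound for every insertion distance, so that `p 0` also dominates
  -- the nodes centered at it.
  set f : ℕ → ℝ := fun i => if i = 0 then max L (∑ j ∈ Finset.range (n + 1), e j) else e i with hf
  set lam : X → ℝ := fun x => f (Function.invFunOn p (Set.Iic n) x) with hlam
  have hlp : ∀ i ≤ n, lam (p i) = f i := fun i hi => by
    simp only [hlam]
    rw [ho.bijOn.injOn.leftInvOn_invFunOn (Set.mem_Iic.2 hi)]
  have hf0 : ∀ i ≤ n, e i ≤ f 0 := fun i hi => by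
    simp only [hf, if_true]
    exact (Finset.single_le_sum (f := e) (fun j _ => he0 j)
      (Finset.mem_range.2 (by omega))).trans (le_max_right _ _)
  have hfpos : ∀ i, 0 < i → f i = e i := fun i hi => by simp [hf, hi.ne']
  have hcenter : t.center = p 0 := by rw [← BallTree.center_shape, hs, Shape.center_grow]
  have hsep : ∀ i j, i < j → j ≤ n → f j ≤ d (p i) (p j) := fun i j hij hj => by
    rw [hfpos j (by omega), hd.comm]
    exact distToPrefix_le hd hij _
  have hnode : ∀ c s a l r, BallTree.node c s a l r ∈ t.nodes → l.center = c ∧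
      s ≤ α * β ^ 3 / (α - 1) * lam c ∧ s ≤ α * β ^ 3 / (α - 1) * lam r.center := by
    intro c s a l r hv
    have hg := BallTree.grown_shape hv (hs ▸ ho.grown hd hα hβ)
    obtain ⟨hc, ⟨i, hi0, hin, hr, hci, hB⟩, -, -⟩ := hg
    rw [BallTree.center_shape] at hc hr
    have hb : s ≤ α / (α - 1) * (β ^ 2 * e i) := by
      obtain ⟨x, hx, hsx⟩ := (hrad _ hv).1
      change s = d c x at hsx
      by_cases hxc : x = c
      · rw [hsx, hxc, hd.self]
        have := he0 i
        positivity
      · obtain ⟨j, h1, h2, rfl, h4⟩ := hB x (by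
          simpa [BallTree.points_shape, BallTree.points] using hx) hxc
        have : 0 ≤ 1 / (α - 1) * d (p j) (p (T j)) := mul_nonneg (by positivity) (hd.nonneg _ _)
        linarith
    have hTi := ho.pred_lt i hi0 hin
    -- The center is the predecessor of `p i`, hence earlier; the third factor `β` in `K` comes from
    -- here.
    have h1 : e i ≤ β * lam c := by
      rw [hci, hlp _ (by omega)]
      have hpos : e i ≤ β * e i := le_mul_of_one_le_left (he0 i) hβ
      rcases Nat.eq_zero_or_pos (T i) with h0 | h0
      · rw [h0]
        exact hpos.trans (mul_le_mul_of_nonneg_left (hf0 i hin) (by linarith))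
      · rw [hfpos _ h0]
        exact ho.insertion_le hd h0 hTi.le hin
    have h2 : e i ≤ β * lam r.center := by
      rw [hr, hlp _ hin, hfpos _ hi0]
      exact le_mul_of_one_le_left (he0 i) hβ
    have aux : ∀ y, e i ≤ β * y → s ≤ α * β ^ 3 / (α - 1) * y := fun y hy => by
      calc s ≤ α / (α - 1) * (β ^ 2 * e i) := hb
        _ ≤ α / (α - 1) * (β ^ 2 * (β * y)) := by gcongr
        _ = _ := by ring
    exact ⟨hc, aux _ h1, aux _ h2⟩
  refine ⟨lam, ?_, ?_, ?_, hrad, fun c s a l r hv => (hnode c s a l r hv).1,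
    fun c s a l r hv => (hnode c s a l r hv).1.symm ▸ (hnode c s a l r hv).2.1,
    fun c s a l r hv => (hnode c s a l r hv).2.2⟩
  · rw [hcenter, hlp 0 (by omega)]
    simp [hf]
  · rw [← BallTree.points_shape, hs]
    exact Shape.nodup_points_grow ho.bijOn.injOn ho.pred_lt
  · intro x hx y hy hxy
    rw [← BallTree.points_shape, hs, Shape.mem_points_grow ho.pred_lt] at hx hy
    obtain ⟨i, hi, rfl⟩ := hx
    obtain ⟨j, hj, rfl⟩ := hy
    rw [hlp i hi, hlp j hj]
    rcases lt_trichotomy i j with h | rfl | h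
    · exact (min_le_right _ _).trans (hsep i j h hj)
    · exact absurd rfl hxy
    · rw [hd.comm]
      exact (min_le_left _ _).trans (hsep j i h hi)

end IsGreedyTree

end GreedyRange

namespace GreedyRange

/-! ### Packing of nodes and the number of splits -/

namespace BallTree

variable {X A : Type u}

/-- The nodes that are not leaves. -/
def innerNodes : BallTree X A → List (BallTree X A)
  | leaf _ _ => []
  | node c s a l r => node c s a l r :: (l.innerNodes ++ r.innerNodes)

/-- The center of the right child. -/
def rightCenter : BallTree X A → X
  | leaf c _ => c
  | node _ _ _ _ r => r.center

theorem innerNodes_subset (t : BallTree X A) : t.innerNodes ⊆ t.nodes := by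
  induction t with
  | leaf => simp [innerNodes]
  | node c s a l r ihl ihr =>
    intro v hv
    simp only [innerNodes, nodes, List.mem_cons, List.mem_append] at hv ⊢
    rcases hv with h | h | h
    · exact .inl h
    · exact .inr (.inl (ihl h))
    · exact .inr (.inr (ihr h))

theorem eq_node_of_mem_innerNodes {t v : BallTree X A} (h : v ∈ t.innerNodes) :
    ∃ c s a l r, v = node c s a l r := by
  induction t with
  | leaf => simp [innerNodes] at h
  | node c s a l r ihl ihr =>
    simp only [innerNodes, List.mem_cons, List.mem_append] at h
    rcases h with h | h | h
    · exact ⟨_, _, _, _, _, h⟩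
    · exact ihl h
    · exact ihr h

theorem left_mem_nodes {c : X} {s : ℝ} {a : A} {l r : BallTree X A} :
    l ∈ (node c s a l r).nodes := by simp [nodes, mem_nodes_self]

theorem right_mem_nodes {c : X} {s : ℝ} {a : A} {l r : BallTree X A} :
    r ∈ (node c s a l r).nodes := by simp [nodes, mem_nodes_self]

namespace Packed

variable {d : X → X → ℝ} {K : ℝ} {lam : X → ℝ} {t : BallTree X A}

theorem of_mem (h : t.Packed d K lam) {v : BallTree X A} (hv : v ∈ t.nodes) :
    v.Packed d K lam where
  nodup := h.nodup.sublist (points_sublist hv)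
  sep x hx y hy := h.sep x ((points_sublist hv).subset hx) y ((points_sublist hv).subset hy)
  greatest w hw := h.greatest w (nodes_subset hv hw)
  center_left c s a l r hw := h.center_left c s a l r (nodes_subset hv hw)
  le_left c s a l r hw := h.le_left c s a l r (nodes_subset hv hw)
  le_right c s a l r hw := h.le_right c s a l r (nodes_subset hv hw)

theorem center_mem (h : t.Packed d K lam) : t.center ∈ t.points := by
  induction t with
  | leaf => simp [center, points]
  | node c s a l r ihl ihr =>
    have := ihl (h.of_mem left_mem_nodes)
    rw [h.center_left c s a l r (mem_nodes_self _)] at this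
    simp [center, points, this]

theorem dist_le_radius (h : t.Packed d K lam) {x : X} (hx : x ∈ t.points) :
    d t.center x ≤ t.radius :=
  (h.greatest t (mem_nodes_self t)).2 ⟨x, hx, rfl⟩

theorem radius_nonneg (h : t.Packed d K lam) (hd : IsMetric d) : 0 ≤ t.radius :=
  (hd.nonneg _ _).trans (h.dist_le_radius h.center_mem)

/-- Radii need not decrease along the tree, since centers change; going through the center of the
ancestor costs a factor 2. -/
theorem radius_le_two_mul (h : t.Packed d K lam) (hd : IsMetric d) {w : BallTree X A}
    (hw : w ∈ t.nodes) : w.radius ≤ 2 * t.radius := by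
  obtain ⟨x, hx, hwx⟩ := (h.greatest w hw).1
  have h1 := h.dist_le_radius ((points_sublist hw).subset hx)
  have h2 := h.dist_le_radius ((points_sublist hw).subset (h.of_mem hw).center_mem)
  have h3 := hd.triangle w.center t.center x
  rw [hd.comm w.center t.center] at h3
  linarith

/-- Centers do not identify inner nodes, as a left child repeats the center of its parent. Centers
of right children do, so splits can be counted by points. -/
theorem rightCenter_innerNodes (h : t.Packed d K lam) :
    (t.innerNodes.map rightCenter).Nodup ∧
      ∀ x ∈ t.innerNodes.map rightCenter, x ∈ t.points ∧ x ≠ t.center := by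
  induction t with
  | leaf => simp [innerNodes]
  | node c s a l r ihl ihr =>
    have hl := h.of_mem (left_mem_nodes (c := c) (s := s) (a := a) (l := l) (r := r))
    have hr := h.of_mem (right_mem_nodes (c := c) (s := s) (a := a) (l := l) (r := r))
    obtain ⟨hl1, hl2⟩ := ihl hl
    obtain ⟨hr1, hr2⟩ := ihr hr
    have hnd := h.nodup
    simp only [points, List.nodup_append'] at hnd
    obtain ⟨-, -, hdis⟩ := hnd
    have hlc := h.center_left c s a l r (mem_nodes_self _)
    simp only [innerNodes, List.map_cons, List.map_append, List.nodup_cons, List.mem_cons,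
      List.mem_append, points, center, List.nodup_append', rightCenter]
    refine ⟨⟨?_, hl1, hr1, fun x hxl hxr => hdis (hl2 x hxl).1 (hr2 x hxr).1⟩, ?_⟩
    · rintro (hx | hx)
      · exact hdis (hl2 _ hx).1 hr.center_mem
      · exact (hr2 _ hx).2 rfl
    · rintro x (rfl | hx | hx)
      · exact ⟨.inr hr.center_mem, fun hc => hdis (hlc ▸ hl.center_mem) (hc ▸ hr.center_mem)⟩
      · exact ⟨.inl (hl2 x hx).1, hlc ▸ (hl2 x hx).2⟩
      · exact ⟨.inr (hr2 x hx).1, fun hc => hdis (hlc ▸ hl.center_mem) (hc ▸ (hr2 x hx).1)⟩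

/-- Every node contains its own center, so the centers form a submultiset of the points below the
nodes. -/
theorem centers_nodup (h : t.Packed d K lam) {E : Multiset (BallTree X A)}
    (hE : ∀ u ∈ E, u ∈ t.nodes) (hnd : (E.bind fun u => (u.points : Multiset X)).Nodup) :
    (E.map center).Nodup := by
  refine Multiset.nodup_of_le ?_ hnd
  clear hnd
  induction E using Multiset.induction_on with
  | empty => simp
  | cons u E ih =>
    rw [Multiset.map_cons, Multiset.cons_bind, ← Multiset.singleton_add]
    refine add_le_add ?_ (ih fun w hw => hE w (Multiset.mem_cons_of_mem hw))
    rw [Multiset.singleton_le]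
    exact (h.of_mem (hE u (Multiset.mem_cons_self _ _))).center_mem

/-- Disjoint nodes with large weights and centers close to each other are few. -/
theorem card_le (h : t.Packed d K lam) (hd : IsMetric d) {P : Finset X} (hP : P.Nontrivial)
    (htP : ∀ x ∈ t.points, x ∈ P) {E : Multiset (BallTree X A)} (hE : ∀ u ∈ E, u ∈ t.nodes)
    (hnd : (E.bind fun u => (u.points : Multiset X)).Nodup) {q : X} {D σ : ℝ} {k : ℕ}
    (hD : ∀ u ∈ E, d q u.center ≤ D) (hσ : ∀ u ∈ E, σ < lam u.center)
    (hk : 4 * D ≤ 2 ^ k * σ) : Multiset.card E ≤ doublingConst d P ^ k := by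
  classical
  have hcard : (E.map center).toFinset.card = Multiset.card E := by
    rw [Multiset.toFinset_card_of_nodup (h.centers_nodup hE hnd), Multiset.card_map]
  rw [← hcard]
  refine card_le_of_separated hd hP (D := 2 * D) ?_ ?_ ?_
  · intro x hx
    obtain ⟨u, hu, rfl⟩ := Multiset.mem_map.1 (Multiset.mem_toFinset.1 hx)
    exact htP _ ((points_sublist (hE u hu)).subset (h.of_mem (hE u hu)).center_mem)
  · intro x hx y hy
    obtain ⟨u, hu, rfl⟩ := Multiset.mem_map.1 (Multiset.mem_toFinset.1 hx)
    obtain ⟨w, hw, rfl⟩ := Multiset.mem_map.1 (Multiset.mem_toFinset.1 hy)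
    have h1 := hd.triangle u.center q w.center
    rw [hd.comm u.center q] at h1
    linarith [hD u hu, hD w hw]
  · intro x hx y hy hxy
    obtain ⟨u, hu, rfl⟩ := Multiset.mem_map.1 (Multiset.mem_toFinset.1 hx)
    obtain ⟨w, hw, rfl⟩ := Multiset.mem_map.1 (Multiset.mem_toFinset.1 hy)
    have h1 := h.sep u.center ((points_sublist (hE u hu)).subset (h.of_mem (hE u hu)).center_mem)
      w.center ((points_sublist (hE w hw)).subset (h.of_mem (hE w hw)).center_mem) hxy
    have h2 : σ < d u.center w.center := (lt_min (hσ u hu) (hσ w hw)).trans_le h1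
    have h3 : (2 : ℝ) ^ k * σ < 2 ^ k * d u.center w.center := by gcongr
    linarith

end Packed

open Classical in
/-- The number of inner nodes below `t` that a range search would split. -/
noncomputable def splitCount (d : X → X → ℝ) (q : X) (r ε : ℝ) (t : BallTree X A) : ℕ :=
  (t.innerNodes.filter fun v =>
    d q v.center ≤ r + v.radius ∧ (1 + ε) * r - v.radius < d q v.center).length

theorem splitCount_node {d : X → X → ℝ} {q : X} {r ε : ℝ} {c : X} {s : ℝ} {a : A}
    {vl vr : BallTree X A} (h1 : d q c ≤ r + s) (h2 : (1 + ε) * r - s < d q c) :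
    (node c s a vl vr).splitCount d q r ε =
      vl.splitCount d q r ε + vr.splitCount d q r ε + 1 := by
  simp [splitCount, innerNodes, center, radius, h1, h2]

/-- The number of splits at each scale is bounded by packing, and the number of scales by the
logarithm of the spread. -/
theorem Packed.splitCount_le {d : X → X → ℝ} {K : ℝ} {lam : X → ℝ} {t : BallTree X A}
    (h : t.Packed d K lam) (hd : IsMetric d) {P : Finset X} (hP : P.Nontrivial)
    (htP : ∀ x ∈ t.points, x ∈ P) (hK : 0 < K) {q : X} {r ε : ℝ} (hr : 0 ≤ r) (hε : 0 < ε) {k : ℕ}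
    (hk : 16 * K * (2 + 1 / ε) ≤ 2 ^ k) :
    t.splitCount d q r ε ≤ doublingConst d P ^ k * (⌊Real.logb 2 (spread d P)⌋₊ + 1) := by
  classical
  obtain ⟨hnd, hrc⟩ := h.rightCenter_innerNodes
  set I := sInf (pairDists d P) with hI
  have hI0 : 0 < I := sInf_pairDists_pos hd hP
  set L := t.innerNodes.filter fun v =>
    d q v.center ≤ r + v.radius ∧ (1 + ε) * r - v.radius < d q v.center with hL
  set f : BallTree X A → ℕ := fun v => ⌊Real.logb 2 (v.radius / I)⌋₊ with hf
  have hLnd : L.Nodup := (List.Nodup.of_map _ hnd).filter _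
  have hmem : ∀ v ∈ L, v ∈ t.innerNodes ∧ v ∈ t.nodes ∧ d q v.center ≤ r + v.radius ∧
      ε * r < 2 * v.radius ∧ ∃ x ∈ P, ∃ y ∈ P, x ≠ y ∧ v.radius = d x y := by
    intro v hv
    obtain ⟨h1, h2⟩ := List.mem_filter.1 hv
    obtain ⟨h2, h3⟩ := of_decide_eq_true h2
    have hvn := innerNodes_subset t h1
    -- A node that passes the first test and fails the second has a radius that is not small
    -- compared with `r`; in particular it is positive, hence a distance between distinct points of
    -- `P`.
    have h4 : ε * r < 2 * v.radius := by linarith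
    obtain ⟨x, hx, hvx⟩ := (h.greatest v hvn).1
    have hsub := (points_sublist hvn).subset
    refine ⟨h1, hvn, h2, h4, _, htP _ (hsub (h.of_mem hvn).center_mem), x, htP _ (hsub hx), ?_, hvx⟩
    rintro hc
    rw [hc, hd.self] at hvx
    have : 0 ≤ ε * r := by positivity
    linarith
  have hcard : t.splitCount d q r ε = L.toFinset.card := (List.toFinset_card_of_nodup hLnd).symm
  rw [hcard]
  refine (Finset.card_le_mul_card_image (f := f) L.toFinset (doublingConst d P ^ k) ?_).trans
    (Nat.mul_le_mul_left _ ?_)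
  · intro j _
    set G := L.toFinset.filter fun v => f v = j with hG
    have hGm : ∀ v ∈ G, v ∈ L ∧ f v = j := fun v hv => by
      simpa [hG] using hv
    have hinj : Set.InjOn rightCenter (G : Set (BallTree X A)) := fun v hv w hw hvw =>
      List.inj_on_of_nodup_map hnd (hmem v (hGm v hv).1).1 (hmem w (hGm w hw).1).1 hvw
    have hscale : ∀ v ∈ G, I * 2 ^ j ≤ v.radius ∧ v.radius < 2 * (I * 2 ^ j) := by
      intro v hv
      obtain ⟨hvL, hvj⟩ := hGm v hv
      obtain ⟨-, -, -, -, x, hx, y, hy, hxy, hvxy⟩ := hmem v hvL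
      have h1 : 1 ≤ v.radius / I := by
        rw [one_le_div hI0, hvxy]; exact sInf_pairDists_le hx hy hxy
      have h2 : (j : ℝ) ≤ Real.logb 2 (v.radius / I) := by
        rw [← hvj]; exact Nat.floor_le (Real.logb_nonneg (by norm_num) h1)
      have h3 : Real.logb 2 (v.radius / I) < ((j + 1 : ℕ) : ℝ) := by
        rw [← hvj]; push_cast; exact Nat.lt_floor_add_one _
      rw [Real.le_logb_iff_rpow_le (by norm_num) (by linarith), Real.rpow_natCast,
        le_div_iff₀ hI0] at h2
      rw [Real.logb_lt_iff_lt_rpow (by norm_num) (by linarith), Real.rpow_natCast,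
        div_lt_iff₀ hI0, pow_succ] at h3
      exact ⟨by linarith, by linarith⟩
    set s := I * 2 ^ j with hs
    have hs0 : 0 < s := by positivity
    -- With radii in `[s, 2 * s)` one has `r ≤ 4 * s / ε`; two more radii lead from `q` via the
    -- center to the center of the right child.
    have hfacts : ∀ v ∈ G, rightCenter v ∈ t.points ∧ d q (rightCenter v) ≤ 2 * (2 * (1 / ε + 1) * s)
        ∧ s ≤ K * lam (rightCenter v) := by
      intro v hv
      obtain ⟨h1, h2, h3, h4, -⟩ := hmem v (hGm v hv).1
      obtain ⟨h5, h6⟩ := hscale v hv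
      obtain ⟨c, σ, a, vl, vr, rfl⟩ := eq_node_of_mem_innerNodes h1
      have hvr := nodes_subset h2 (right_mem_nodes (c := c) (s := σ) (a := a) (l := vl) (r := vr))
      have hmem' := (h.of_mem hvr).center_mem
      refine ⟨(points_sublist hvr).subset hmem', ?_, h5.trans (h.le_right c σ a vl vr h2)⟩
      have h7 := (h.of_mem h2).dist_le_radius (x := vr.center) (by simp [points, hmem'])
      have h8 := hd.triangle q c vr.center
      have h9 : r ≤ 1 / ε * (2 * (2 * s)) := by
        rw [one_div, inv_mul_eq_div, le_div_iff₀ hε]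
        linarith
      change d q c ≤ r + σ at h3
      change d c vr.center ≤ σ at h7
      change σ < 2 * s at h6
      change d q vr.center ≤ _
      nlinarith
    rw [← Finset.card_image_of_injOn hinj]
    refine card_le_of_separated hd hP (D := 4 * (2 * (1 / ε + 1) * s)) ?_ ?_ ?_
    · intro x hx
      obtain ⟨v, hv, rfl⟩ := Finset.mem_image.1 hx
      exact htP _ (hfacts v hv).1
    · intro x hx y hy
      obtain ⟨v, hv, rfl⟩ := Finset.mem_image.1 hx
      obtain ⟨w, hw, rfl⟩ := Finset.mem_image.1 hy
      have h1 := hd.triangle (rightCenter v) q (rightCenter w)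
      rw [hd.comm (rightCenter v) q] at h1
      linarith [(hfacts v hv).2.1, (hfacts w hw).2.1]
    · intro x hx y hy hxy
      obtain ⟨v, hv, rfl⟩ := Finset.mem_image.1 hx
      obtain ⟨w, hw, rfl⟩ := Finset.mem_image.1 hy
      obtain ⟨hv1, -, hv3⟩ := hfacts v hv
      obtain ⟨hw1, -, hw3⟩ := hfacts w hw
      have h1 := h.sep _ hv1 _ hw1 hxy
      have h2 : s ≤ K * d (rightCenter v) (rightCenter w) := by
        rcases min_le_iff.1 h1 with h1 | h1
        · exact hv3.trans (mul_le_mul_of_nonneg_left h1 hK.le)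
        · exact hw3.trans (mul_le_mul_of_nonneg_left h1 hK.le)
      have h3 : 16 * K * (2 + 1 / ε) * d (rightCenter v) (rightCenter w) ≤
          2 ^ k * d (rightCenter v) (rightCenter w) :=
        mul_le_mul_of_nonneg_right hk (hd.nonneg _ _)
      -- The separation needed is `16 * (1 / ε + 1) * s < 2 ^ k * d`; having 2 in place of 1 in `hk`
      -- makes it strict.
      have h4 : 16 * (2 + 1 / ε) * s ≤
          16 * (2 + 1 / ε) * (K * d (rightCenter v) (rightCenter w)) := by gcongr
      nlinarith
  · refine (Finset.card_le_card (t := Finset.range (⌊Real.logb 2 (spread d P)⌋₊ + 1)) ?_).trans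
      (Finset.card_range _).le
    intro j hj
    obtain ⟨v, hv, rfl⟩ := Finset.mem_image.1 hj
    obtain ⟨-, -, -, -, x, hx, y, hy, hxy, hvxy⟩ := hmem v (List.mem_toFinset.1 hv)
    rw [Finset.mem_range, hf]
    dsimp only
    rw [hvxy]
    exact floor_logb_lt hd hP hx hy hxy

end BallTree

/-! ## Heaps -/

namespace Heap

variable {B : Type u}

/-- The entries of a heap. -/
def elems : Heap B → Multiset B
  | nil => 0
  | node _ v l r => v ::ₘ (l.elems + r.elems)

/-- The heap order. -/
def IsMaxHeap (key : B → ℝ) : Heap B → Prop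
  | nil => True
  | node _ v l r => (∀ u ∈ l.elems + r.elems, key u ≤ key v) ∧
      l.IsMaxHeap key ∧ r.IsMaxHeap key

theorem elems_make (v : B) (a b : Heap B) : (make v a b).elems = v ::ₘ (a.elems + b.elems) := by
  unfold make
  split
  · rfl
  · simp only [elems, add_comm]

theorem IsMaxHeap.make {key : B → ℝ} {v : B} {a b : Heap B}
    (h : ∀ u ∈ a.elems + b.elems, key u ≤ key v) (ha : a.IsMaxHeap key) (hb : b.IsMaxHeap key) :
    (make v a b).IsMaxHeap key := by
  unfold Heap.make
  split
  · exact ⟨h, ha, hb⟩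
  · exact ⟨add_comm a.elems b.elems ▸ h, hb, ha⟩

theorem elems_merge (key : B → ℝ) (g h : Heap B) :
    (merge key g h).val.elems = g.elems + h.elems := by
  fun_induction merge key g h with
  | case1 h => simp [elems]
  | case2 k v l r => simp [elems]
  | case3 k v l r k₂ v₂ l₂ r₂ hk h ih =>
    simp only [elems_make, ih, h, elems, ← Multiset.singleton_add]; abel
  | case4 k v l r k₂ v₂ l₂ r₂ hk h ih =>
    simp only [elems_make, ih, h, elems, ← Multiset.singleton_add]; abel

theorem IsMaxHeap.merge {key : B → ℝ} {g h : Heap B} (hg : g.IsMaxHeap key)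
    (hh : h.IsMaxHeap key) : (merge key g h).val.IsMaxHeap key := by
  fun_induction Heap.merge key g h with
  | case1 h => exact hh
  | case2 k v l r => exact hg
  | case3 k v l r k₂ v₂ l₂ r₂ hk h ih =>
    refine IsMaxHeap.make (fun u hu => ?_) hg.2.1 (ih hg.2.2 hh)
    simp only [h, elems_merge, elems, Multiset.mem_add, Multiset.mem_cons] at hu
    rcases hu with hu | hu | rfl | hu | hu
    · exact hg.1 u (by simp [hu])
    · exact hg.1 u (by simp [hu])
    · exact hk
    · exact (hh.1 u (by simp [hu])).trans hk
    · exact (hh.1 u (by simp [hu])).trans hk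
  | case4 k v l r k₂ v₂ l₂ r₂ hk h ih =>
    have hk' := (not_le.1 hk).le
    refine IsMaxHeap.make (fun u hu => ?_) hh.2.1 (ih hg hh.2.2)
    simp only [h, elems_merge, elems, Multiset.mem_add, Multiset.mem_cons] at hu
    rcases hu with hu | (rfl | hu | hu) | hu
    · exact hh.1 u (by simp [hu])
    · exact hk'
    · exact (hg.1 u (by simp [hu])).trans hk'
    · exact (hg.1 u (by simp [hu])).trans hk'
    · exact hh.1 u (by simp [hu])

/-- A linear bound suffices, because packing bounds the size of the heap; the ranks of leftist heaps
play no role. -/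
theorem time_merge_le (key : B → ℝ) (g h : Heap B) :
    (merge key g h).time ≤ Multiset.card g.elems + Multiset.card h.elems + 1 := by
  fun_induction merge key g h with
  | case1 h => simp
  | case2 k v l r => simp
  | case3 k v l r k₂ v₂ l₂ r₂ hk h ih =>
    simp only [h, elems, Multiset.card_cons, Multiset.card_add] at ih ⊢; omega
  | case4 k v l r k₂ v₂ l₂ r₂ hk h ih =>
    simp only [h, elems, Multiset.card_cons, Multiset.card_add] at ih ⊢; omega

theorem elems_push (key : B → ℝ) (v : B) (h : Heap B) :
    (push key v h).val.elems = v ::ₘ h.elems := by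
  simp [push, elems_merge, elems]

theorem IsMaxHeap.push {key : B → ℝ} {h : Heap B} (hh : h.IsMaxHeap key) (v : B) :
    (push key v h).val.IsMaxHeap key :=
  IsMaxHeap.merge ⟨by simp [elems], trivial, trivial⟩ hh

theorem time_push_le (key : B → ℝ) (v : B) (h : Heap B) :
    (push key v h).time ≤ Multiset.card h.elems + 3 := by
  have := time_merge_le key (node 1 v nil nil) h
  simp only [elems, Multiset.card_cons, Multiset.card_add, Multiset.card_zero] at this
  simp only [push]
  omega

end Heap

end GreedyRange

namespace GreedyRange

/-! ## Range search -/

section Search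

variable {X A : Type u} {d : X → X → ℝ} {q : X} {r ε K : ℝ} {lam : X → ℝ} {t : BallTree X A}

/-- All points below the given nodes. -/
def pointsBelow (E : Multiset (BallTree X A)) : Multiset X :=
  E.bind fun u => (u.points : Multiset X)

/-- What is known about the nodes in the heap during a range search. -/
structure Frontier (d : X → X → ℝ) (q : X) (r ε K : ℝ) (lam : X → ℝ) (t : BallTree X A)
    (E : Multiset (BallTree X A)) : Prop where
  mem : ∀ u ∈ E, u ∈ t.nodes
  viable : ∀ u ∈ E, d q u.center ≤ r + u.radius
  nodup : (pointsBelow E).Nodup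
  scale : ∃ μ, ε * r < 2 * μ ∧ ∀ u ∈ E, μ ≤ K * lam u.center ∧ ∀ w ∈ u.nodes, w.radius ≤ 2 * μ

/-- What is known about the nodes found by a range search from a heap with the points `S`. -/
structure Found (d : X → X → ℝ) (q : X) (r ε K : ℝ) (lam : X → ℝ) (t : BallTree X A)
    (S : Multiset X) (L : List (BallTree X A)) : Prop where
  mem : ∀ v ∈ L, v ∈ t.nodes
  inside : ∀ v ∈ L, d q v.center ≤ (1 + ε) * r - v.radius
  weight : ∀ v ∈ L, ε * r < 2 * (K * lam v.center)
  points_le : pointsBelow (L : Multiset (BallTree X A)) ≤ S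
  complete : ∀ x ∈ S, d q x ≤ r → ∃ v ∈ L, x ∈ v.points

theorem pointsBelow_cons (u : BallTree X A) (E : Multiset (BallTree X A)) :
    pointsBelow (u ::ₘ E) = (u.points : Multiset X) + pointsBelow E :=
  Multiset.cons_bind _ _ _

theorem pointsBelow_add (E F : Multiset (BallTree X A)) :
    pointsBelow (E + F) = pointsBelow E + pointsBelow F :=
  Multiset.add_bind _ _ _

theorem pointsBelow_le {E F : Multiset (BallTree X A)} (h : E ≤ F) :
    pointsBelow E ≤ pointsBelow F := by
  obtain ⟨G, rfl⟩ := Multiset.le_iff_exists_add.1 h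
  rw [pointsBelow_add]
  exact Multiset.le_add_right _ _

theorem Frontier.mono {E F : Multiset (BallTree X A)} (hF : Frontier d q r ε K lam t F)
    (h : E ≤ F) : Frontier d q r ε K lam t E where
  mem u hu := hF.mem u (Multiset.mem_of_le h hu)
  viable u hu := hF.viable u (Multiset.mem_of_le h hu)
  nodup := Multiset.nodup_of_le (pointsBelow_le h) hF.nodup
  scale := hF.scale.imp fun _ hμ => ⟨hμ.1, fun u hu => hμ.2 u (Multiset.mem_of_le h hu)⟩

/-- The new scale is `min μ s`. It still exceeds `ε * r / 2` because the split node passed the first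
test and failed the second. The children are heavy enough since `s` is bounded by their weights. The
other nodes have radius at most `s` by maximality, so every radius below them is at most `2 * s`;
this is where the heap order enters. -/
theorem Frontier.split {E F : Multiset (BallTree X A)} {c : X} {s : ℝ} {a : A}
    {vl vr : BallTree X A} (ht : t.Packed d K lam) (hd : IsMetric d)
    (hE : Frontier d q r ε K lam t (.node c s a vl vr ::ₘ E)) (hmax : ∀ u ∈ E, u.radius ≤ s)
    (hout : (1 + ε) * r - s < d q c) (hF : F ≤ {vl, vr}) (hFv : ∀ u ∈ F, d q u.center ≤ r + u.radius) :
    Frontier d q r ε K lam t (F + E) := by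
  have hv := hE.mem _ (Multiset.mem_cons_self _ _)
  have hFlr : ∀ u ∈ F, u = vl ∨ u = vr := fun u hu => by
    simpa using Multiset.mem_of_le hF hu
  have hFn : ∀ u ∈ F, u ∈ (BallTree.node c s a vl vr).nodes := fun u hu => by
    rcases hFlr u hu with rfl | rfl
    · exact BallTree.left_mem_nodes
    · exact BallTree.right_mem_nodes
  have hmem : ∀ u ∈ F + E, u ∈ t.nodes := fun u hu => by
    rcases Multiset.mem_add.1 hu with hu | hu
    · exact BallTree.nodes_subset hv (hFn u hu)
    · exact hE.mem u (Multiset.mem_cons_of_mem hu)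
  refine ⟨hmem, fun u hu => ?_, ?_, ?_⟩
  · rcases Multiset.mem_add.1 hu with hu | hu
    · exact hFv u hu
    · exact hE.viable u (Multiset.mem_cons_of_mem hu)
  · refine Multiset.nodup_of_le ?_ hE.nodup
    rw [pointsBelow_add, pointsBelow_cons]
    refine add_le_add ((pointsBelow_le hF).trans_eq ?_) le_rfl
    change (({vl, vr} : Multiset (BallTree X A)).bind fun u => (u.points : Multiset X)) = _
    simp [BallTree.points]
  · obtain ⟨μ, hμ, hall⟩ := hE.scale
    have hvi := hE.viable _ (Multiset.mem_cons_self _ _)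
    change d q c ≤ r + s at hvi
    refine ⟨min μ s, ?_, fun u hu => ?_⟩
    · rcases min_choice μ s with h | h <;> rw [h]
      · exact hμ
      · linarith
    rcases Multiset.mem_add.1 hu with hu' | hu'
    · refine ⟨(min_le_right _ _).trans ?_, fun w hw => ?_⟩
      · rcases hFlr u hu' with rfl | rfl
        · exact ht.le_left _ _ _ _ _ hv
        · exact ht.le_right _ _ _ _ _ hv
      · have hw' := BallTree.nodes_subset (hFn u hu') hw
        have h1 := (hall _ (Multiset.mem_cons_self _ _)).2 w hw'
        have h2 := (ht.of_mem hv).radius_le_two_mul hd hw'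
        change _ ≤ 2 * s at h2
        rcases min_choice μ s with h | h <;> rw [h] <;> assumption
    · obtain ⟨h1, h2⟩ := hall u (Multiset.mem_cons_of_mem hu')
      refine ⟨(min_le_left _ _).trans h1, fun w hw => ?_⟩
      have h3 := (ht.of_mem (hmem u hu)).radius_le_two_mul hd hw
      have h4 := hmax u hu'
      have h5 := h2 w hw
      rcases min_choice μ s with h | h <;> rw [h] <;> linarith

theorem Frontier.card_le {E : Multiset (BallTree X A)} (hE : Frontier d q r ε K lam t E)
    (ht : t.Packed d K lam) (hd : IsMetric d) {P : Finset X} (hP : P.Nontrivial)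
    (htP : ∀ x ∈ t.points, x ∈ P) (hK : 0 < K) (hr : 0 ≤ r) (hε : 0 < ε) {k : ℕ}
    (hk : 16 * K * (2 + 1 / ε) ≤ 2 ^ k) : Multiset.card E ≤ doublingConst d P ^ k := by
  obtain ⟨μ, hμ, hall⟩ := hE.scale
  have hμ0 : 0 < μ := by
    have : 0 ≤ ε * r := by positivity
    linarith
  -- `D` bounds `r + u.radius` through `r ≤ 2 * μ / ε` and `u.radius ≤ 2 * μ`; halving `μ / K` makes
  -- the bound on the weights strict.
  refine ht.card_le hd hP htP hE.mem hE.nodup (q := q) (D := 2 * μ * (1 / ε + 1))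
    (σ := μ / (2 * K)) (fun u hu => ?_) (fun u hu => ?_) ?_
  · have h1 := hE.viable u hu
    have h2 := (hall u hu).2 u (BallTree.mem_nodes_self u)
    have h3 : r ≤ 1 / ε * (2 * μ) := by
      rw [one_div, inv_mul_eq_div, le_div_iff₀ hε]; linarith
    linarith
  · rw [div_lt_iff₀ (by positivity)]
    have := (hall u hu).1
    linarith
  · calc 4 * (2 * μ * (1 / ε + 1)) ≤ 8 * (2 + 1 / ε) * μ := by
          nlinarith
      _ = 16 * K * (2 + 1 / ε) * (μ / (2 * K)) := by field_simp; ring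
      _ ≤ _ := by gcongr

/-- Nodes put out inherit from the heap a weight above `ε * r / (2 * K)`, and their centers lie in
the ball of radius `(1 + ε) * r`. -/
theorem Found.length_le {S : Multiset X} {L : List (BallTree X A)}
    (hL : Found d q r ε K lam t S L) (hS : S.Nodup)
    (ht : t.Packed d K lam) (hd : IsMetric d) {P : Finset X} (hP : P.Nontrivial)
    (htP : ∀ x ∈ t.points, x ∈ P) (hK : 0 < K) (hr : 0 ≤ r) (hε : 0 < ε) {k : ℕ}
    (hk : 16 * K * (2 + 1 / ε) ≤ 2 ^ k) : L.length ≤ doublingConst d P ^ k := by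
  refine ht.card_le hd hP htP (E := (L : Multiset (BallTree X A))) hL.mem
    (Multiset.nodup_of_le hL.points_le hS) (q := q) (D := (1 + ε) * r)
    (σ := ε * r / (2 * K)) (fun u hu => ?_) (fun u hu => ?_) ?_
  · have h1 := hL.inside u hu
    have h2 := (ht.of_mem (hL.mem u hu)).radius_nonneg hd
    linarith
  · rw [div_lt_iff₀ (by positivity)]
    have := hL.weight u hu
    linarith
  · calc 4 * ((1 + ε) * r) ≤ 8 * (2 * ε + 1) * r := by nlinarith [mul_nonneg hε.le hr]
      _ = 16 * K * (2 + 1 / ε) * (ε * r / (2 * K)) := by field_simp; ring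
      _ ≤ _ := by gcongr

/-- The node goes to the end of the list, since the loop puts it in front of `out` before the nodes
of the later rounds. -/
theorem Found.cons {E : Multiset (BallTree X A)} {v : BallTree X A} {L : List (BallTree X A)}
    (hE : Frontier d q r ε K lam t (v ::ₘ E))
    (hv : d q v.center ≤ (1 + ε) * r - v.radius)
    (hL : Found d q r ε K lam t (pointsBelow E) L) :
    Found d q r ε K lam t (pointsBelow (v ::ₘ E)) (L ++ [v]) := by
  have hvE := Multiset.mem_cons_self v E
  refine ⟨fun w hw => ?_, fun w hw => ?_, fun w hw => ?_, ?_, fun x hx hqx => ?_⟩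
  · rcases List.mem_append.1 hw with hw | hw
    · exact hL.mem w hw
    · rw [List.mem_singleton.1 hw]; exact hE.mem v hvE
  · rcases List.mem_append.1 hw with hw | hw
    · exact hL.inside w hw
    · rw [List.mem_singleton.1 hw]; exact hv
  · rcases List.mem_append.1 hw with hw | hw
    · exact hL.weight w hw
    · rw [List.mem_singleton.1 hw]
      obtain ⟨μ, hμ, hall⟩ := hE.scale
      linarith [(hall v hvE).1]
  · rw [← Multiset.coe_add, pointsBelow_add, pointsBelow_cons, add_comm]
    refine add_le_add ?_ hL.points_le
    simp [pointsBelow]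
  · rw [pointsBelow_cons, Multiset.mem_add] at hx
    rcases hx with hx | hx
    · exact ⟨v, by simp, hx⟩
    · obtain ⟨w, hw, hxw⟩ := hL.complete x hx hqx
      exact ⟨w, by simp [hw], hxw⟩

/-- The cost of a search from a heap, in rounds of the main loop. -/
noncomputable def rounds (d : X → X → ℝ) (q : X) (r ε : ℝ) (E : Multiset (BallTree X A)) : ℕ :=
  (E.map fun u => 1 + 2 * u.splitCount d q r ε).sum

theorem pushViable_spec (d : X → X → ℝ) (q : X) (r : ℝ) (v : BallTree X A)
    {H : Heap (BallTree X A)} (hH : H.IsMaxHeap BallTree.radius) :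
    (pushViable d q r v H).val.IsMaxHeap BallTree.radius ∧
    (pushViable d q r v H).time ≤ Multiset.card H.elems + 5 ∧
    ∃ F : Multiset (BallTree X A), F ≤ {v} ∧ (pushViable d q r v H).val.elems = F + H.elems ∧
      (∀ u ∈ F, d q u.center ≤ r + u.radius) ∧ (d q v.center ≤ r + v.radius → F = {v}) := by
  unfold pushViable
  split
  · next h =>
    refine ⟨hH.push v, ?_, {v}, le_rfl, ?_, by simpa using h, fun _ => rfl⟩
    · have := Heap.time_push_le BallTree.radius v H
      dsimp only
      omega
    · simp [Heap.elems_push]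
  · next h => exact ⟨hH, by simp, 0, by simp, by simp, by simp, fun h' => absurd h' h⟩

/-- The frontier invariant survives every round and keeps the heap at no more than `N` nodes, so one
merge and two pushes cost at most `3 * N + 12` with the overhead. The potential `rounds` falls by at
least one in each round. -/
theorem searchLoop_spec (ht : t.Packed d K lam) (hd : IsMetric d) (hr : 0 ≤ r) (hε : 0 < ε) {N : ℕ}
    (hN : ∀ E, Frontier d q r ε K lam t E → Multiset.card E ≤ N)
    (H : Heap (BallTree X A)) (out : List (BallTree X A)) (hH : H.IsMaxHeap BallTree.radius)
    (hE : Frontier d q r ε K lam t H.elems) :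
    (∃ L, (searchLoop d q r ε H out).val = L ++ out ∧
      Found d q r ε K lam t (pointsBelow H.elems) L) ∧
    (searchLoop d q r ε H out).time ≤ 1 + (3 * N + 12) * rounds d q r ε H.elems := by
  fun_induction searchLoop d q r ε H out with
  | case1 out =>
    refine ⟨⟨[], rfl, by simp, by simp, by simp, by simp [pointsBelow], ?_⟩, by simp⟩
    simp [Heap.elems, pointsBelow]
  | case2 out k v L R H₀ hv res ih =>
    have hH0 : H₀.val.elems = L.elems + R.elems := Heap.elems_merge _ _ _
    have ht0 : H₀.time ≤ Multiset.card (L.elems + R.elems) + 1 := by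
      simpa using Heap.time_merge_le BallTree.radius L R
    have hcard := hN _ hE
    simp only [Heap.elems, Multiset.card_cons] at hE hcard
    have hih := ih (Heap.IsMaxHeap.merge hH.2.1 hH.2.2)
      (hH0 ▸ hE.mono (Multiset.le_cons_self _ _))
    rw [hH0] at hih
    obtain ⟨⟨M, hM, hF⟩, htime⟩ := hih
    refine ⟨⟨M ++ [v], by simpa [res] using hM, hF.cons hE hv⟩, ?_⟩
    have hrounds : rounds d q r ε (L.elems + R.elems) + 1 ≤
        rounds d q r ε (v ::ₘ (L.elems + R.elems)) := by
      simp only [rounds, Multiset.map_cons, Multiset.sum_cons]; omega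
    have := Nat.mul_le_mul_left (3 * N + 12) hrounds
    change res.time + _ + 2 ≤ _
    change res.time ≤ _ at htime
    simp only [Heap.elems]
    rw [Nat.mul_add] at this
    omega
  | case3 out k L R H₀ c a res hv ih =>
    -- A leaf has radius 0, so passing the first test implies passing the second.
    exfalso
    have h1 := hE.viable (.leaf c a) (by simp [Heap.elems])
    simp only [BallTree.center, BallTree.radius] at h1 hv
    apply hv
    nlinarith [mul_nonneg hε.le hr]
  | case4 out k L R H₀ c s a vL vR H₁ H₂ res hv ih =>
    have hH0 : H₀.val.elems = L.elems + R.elems := Heap.elems_merge _ _ _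
    have ht0 : H₀.time ≤ Multiset.card (L.elems + R.elems) + 1 := by
      simpa using Heap.time_merge_le BallTree.radius L R
    have hcard := hN _ hE
    simp only [Heap.elems, Multiset.card_cons] at hE hcard
    have hv' : (1 + ε) * r - s < d q c := not_le.1 hv
    have hmem := hE.mem _ (Multiset.mem_cons_self _ _)
    obtain ⟨hp1, hq1, F₁, hF1, he1, hv1, hc1⟩ := pushViable_spec d q r vR
      (Heap.IsMaxHeap.merge hH.2.1 hH.2.2)
    obtain ⟨hp2, hq2, F₂, hF2, he2, hv2, hc2⟩ := pushViable_spec d q r vL hp1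
    have hcardF1 : Multiset.card F₁ ≤ 1 := by simpa using Multiset.card_le_card hF1
    have hle : F₂ + F₁ ≤ {vL, vR} := by
      have := add_le_add hF2 hF1
      simpa using this
    have helems : H₂.val.elems = F₂ + F₁ + (L.elems + R.elems) := by
      rw [add_assoc, ← hH0, ← he1, ← he2]
    have hfr : Frontier d q r ε K lam t (F₂ + F₁ + (L.elems + R.elems)) := by
      refine hE.split ht hd hH.1 hv' hle fun u hu => ?_
      rcases Multiset.mem_add.1 hu with hu | hu
      · exact hv2 u hu
      · exact hv1 u hu
    have hih := ih hp2 (helems ▸ hfr)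
    rw [helems] at hih
    obtain ⟨⟨M, hM, hF⟩, htime⟩ := hih
    have hpts : pointsBelow (F₂ + F₁) ≤ ((vL.points ++ vR.points : List X) : Multiset X) := by
      refine (pointsBelow_le hle).trans_eq ?_
      change (({vL, vR} : Multiset (BallTree X A)).bind fun u => (u.points : Multiset X)) = _
      simp
    refine ⟨⟨M, hM, hF.mem, hF.inside, hF.weight, hF.points_le.trans ?_, fun x hx hqx => ?_⟩, ?_⟩
    · simp only [Heap.elems]
      rw [pointsBelow_add, pointsBelow_cons]
      exact add_le_add hpts le_rfl
    · refine hF.complete x ?_ hqx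
      simp only [Heap.elems] at hx
      rw [pointsBelow_cons, Multiset.mem_add] at hx
      rw [pointsBelow_add, Multiset.mem_add]
      refine hx.imp_left fun hx => ?_
      -- A node above a point of the query ball always passes the first test, so the child
      -- containing `x` is not discarded.
      have hviable : ∀ u ∈ t.nodes, x ∈ u.points → d q u.center ≤ r + u.radius := by
        intro u hu hxu
        have h1 := (ht.of_mem hu).dist_le_radius hxu
        have h2 := hd.triangle q x u.center
        rw [hd.comm x] at h2
        linarith
      simp only [BallTree.points, Multiset.mem_coe, List.mem_append] at hx
      rw [pointsBelow_add, Multiset.mem_add]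
      rcases hx with hx | hx
      · left
        rw [hc2 (hviable vL (BallTree.nodes_subset hmem BallTree.left_mem_nodes) hx)]
        simpa [pointsBelow] using hx
      · right
        rw [hc1 (hviable vR (BallTree.nodes_subset hmem BallTree.right_mem_nodes) hx)]
        simpa [pointsBelow] using hx
    · have hr1 : rounds d q r ε F₁ ≤ 1 + 2 * vR.splitCount d q r ε := by
        obtain ⟨G, hG⟩ := Multiset.le_iff_exists_add.1 hF1
        have : rounds d q r ε {vR} = rounds d q r ε F₁ + rounds d q r ε G := by
          rw [hG]; simp [rounds]
        simp only [rounds, Multiset.map_singleton, Multiset.sum_singleton] at this ⊢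
        omega
      have hr2 : rounds d q r ε F₂ ≤ 1 + 2 * vL.splitCount d q r ε := by
        obtain ⟨G, hG⟩ := Multiset.le_iff_exists_add.1 hF2
        have : rounds d q r ε {vL} = rounds d q r ε F₂ + rounds d q r ε G := by
          rw [hG]; simp [rounds]
        simp only [rounds, Multiset.map_singleton, Multiset.sum_singleton] at this ⊢
        omega
      have hsc := BallTree.splitCount_node (c := c) (s := s) (a := a) (vl := vL) (vr := vR)
        (hE.viable _ (Multiset.mem_cons_self _ _)) hv'
      -- The split node contributes `1 + 2` beyond the split counts of its children, and the
      -- children need at most `1 + 1`.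
      have hrounds : rounds d q r ε (F₂ + F₁ + (L.elems + R.elems)) + 1 ≤
          rounds d q r ε (.node c s a vL vR ::ₘ (L.elems + R.elems)) := by
        simp only [rounds, Multiset.map_cons, Multiset.sum_cons, Multiset.map_add,
          Multiset.sum_add] at hr1 hr2 ⊢
        omega
      have := Nat.mul_le_mul_left (3 * N + 12) hrounds
      have he0 := congrArg Multiset.card hH0
      have he1' := congrArg Multiset.card he1
      simp only [Multiset.card_add] at he0 he1' ht0 hcard
      change res.time + H₀.time + H₁.time + H₂.time + 2 ≤ _
      change res.time ≤ _ at htime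
      change H₁.time ≤ Multiset.card H₀.val.elems + 5 at hq1
      change H₂.time ≤ Multiset.card H₁.val.elems + 5 at hq2
      change Multiset.card H₁.val.elems = _ + Multiset.card H₀.val.elems at he1'
      simp only [Heap.elems]
      rw [Nat.mul_add] at this
      omega

/-- Correctness and cost of a range search in a greedy tree. -/
theorem rangeSearch_spec {α β : ℝ} (hα : 1 < α) (hβ : 1 ≤ β) {S : Set X}
    (h : IsGreedyTree α β d S t) (hd : IsMetric d) {P : Finset X} (hP : P.Nontrivial)
    (hSP : S ⊆ P) (hr : 0 ≤ r) (hε : 0 < ε) {k : ℕ}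
    (hk : 16 * (α * β ^ 3 / (α - 1)) * (2 + 1 / ε) ≤ 2 ^ k) (out : List (BallTree X A)) :
    (∃ L : List (BallTree X A), (rangeSearch d q r ε t out).val = L ++ out ∧
      L.length ≤ doublingConst d P ^ k ∧ (∀ v ∈ L, v ∈ t.nodes) ∧
      (∀ v ∈ L, ∀ x ∈ v.points, d q x ≤ (1 + ε) * r) ∧
      (L.flatMap BallTree.points).Subperm t.points ∧
      ∀ x ∈ t.points, d q x ≤ r → ∃ v ∈ L, x ∈ v.points) ∧
    (rangeSearch d q r ε t out).time ≤ 52 * (doublingConst d P ^ k) ^ 2 *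
      (⌊Real.logb 2 (spread d P)⌋₊ + 1) := by
  have hα' : 0 < α - 1 := by linarith
  set K := α * β ^ 3 / (α - 1) with hK
  have hK0 : 0 < K := by positivity
  -- The root gets a weight for which `μ = t.radius + ε * r + 1` starts the frontier invariant, even
  -- when `r = 0`.
  obtain ⟨lam, hlam, ht⟩ := h.exists_packed hd hα hβ ((t.radius + ε * r + 1) / K)
  rw [div_le_iff₀' hK0] at hlam
  have hρ : 1 ≤ t.radius + ε * r + 1 := by
    have := ht.radius_nonneg hd
    have : 0 ≤ ε * r := by positivity
    linarith
  have htP : ∀ x ∈ t.points, x ∈ P := fun x hx => hSP (h.mem_points_iff.1 hx)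
  set N := doublingConst d P ^ k with hN
  set Λ := ⌊Real.logb 2 (spread d P)⌋₊ + 1 with hΛ
  have hN1 : 1 ≤ N := Nat.one_le_pow _ _ (by have := two_le_doublingConst hd hP; omega)
  obtain ⟨hp, hq, F, hF, he, hv, hc⟩ := pushViable_spec d q r t (H := .nil) trivial
  simp only [Heap.elems, add_zero, Multiset.card_zero] at he hq
  have hroot : ∀ u ∈ F, u = t := fun u hu => by simpa using Multiset.mem_of_le hF hu
  have hFpts : pointsBelow F ≤ (t.points : Multiset X) :=
    (pointsBelow_le hF).trans_eq (by simp [pointsBelow])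
  have hFr : Frontier d q r ε K lam t F := by
    refine ⟨fun u hu => hroot u hu ▸ BallTree.mem_nodes_self t, hv,
      Multiset.nodup_of_le hFpts ht.nodup, t.radius + ε * r + 1, ?_, fun u hu => ?_⟩
    · have := ht.radius_nonneg hd
      have : 0 ≤ ε * r := by positivity
      linarith
    · rw [hroot u hu]
      refine ⟨hlam, fun w hw => (ht.radius_le_two_mul hd hw).trans ?_⟩
      have : 0 ≤ ε * r := by positivity
      linarith
  obtain ⟨⟨L, hL, hfound⟩, htime⟩ := searchLoop_spec ht hd hr hε
    (fun E hE => hE.card_le ht hd hP htP hK0 hr hε hk) (pushViable d q r t .nil).val out hp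
    (he ▸ hFr)
  rw [he] at hfound htime
  rw [← hN] at htime
  refine ⟨⟨L, hL, hfound.length_le hFr.nodup ht hd hP htP hK0 hr hε hk, hfound.mem,
    fun v hv x hx => ?_, ?_, fun x hx hqx => ?_⟩, ?_⟩
  · have h1 := hfound.inside v hv
    have h2 := (ht.of_mem (hfound.mem v hv)).dist_le_radius hx
    have h3 := hd.triangle q v.center x
    linarith
  · have := hfound.points_le.trans hFpts
    rwa [pointsBelow, Multiset.coe_bind, Multiset.coe_le] at this
  · refine hfound.complete x ?_ hqx
    rw [hc]
    · simpa [pointsBelow] using hx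
    · have h1 := ht.dist_le_radius hx
      have h2 := hd.triangle q x t.center
      rw [hd.comm x] at h2
      linarith
  · have hsc := ht.splitCount_le hd hP htP hK0 (q := q) hr hε hk
    rw [← hN, ← hΛ] at hsc
    have hrF : rounds d q r ε F ≤ 1 + 2 * (N * Λ) := by
      obtain ⟨G, hG⟩ := Multiset.le_iff_exists_add.1 hF
      have : rounds d q r ε {t} = rounds d q r ε F + rounds d q r ε G := by
        rw [hG]; simp [rounds]
      simp only [rounds, Multiset.map_singleton, Multiset.sum_singleton] at this ⊢
      omega
    change (searchLoop d q r ε (pushViable d q r t .nil).val out).time +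
      (pushViable d q r t .nil).time + 1 ≤ _
    have hΛ1 : 1 ≤ Λ := Nat.le_add_left _ _
    have h1 : 1 ≤ N * Λ := Nat.one_le_iff_ne_zero.2 (by positivity)
    -- From `N ≥ 1` and `N * Λ ≥ 1`; the remaining 7 of the 52 pay for the initial push and the
    -- constant steps.
    have h2 : (3 * N + 12) * rounds d q r ε F ≤ (15 * N) * (3 * (N * Λ)) :=
      Nat.mul_le_mul (by omega) (by omega)
    have h3 : (15 * N) * (3 * (N * Λ)) = 45 * (N ^ 2 * Λ) := by ring
    have h4 : 1 ≤ N ^ 2 * Λ := Nat.one_le_iff_ne_zero.2 (by positivity)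
    rw [mul_assoc]
    omega

end Search

end GreedyRange

namespace GreedyRange

/-! ## Queries in range trees -/

section Query

variable {X A : Type u} {q : X} {ε α β : ℝ} {P : Finset X} {k : ℕ}

/-- The trees live on subsets of `P`, but all packing is done in `P`: a subset admits fewer centers
for covering, so its own doubling constant need not be smaller. -/
theorem searchAll_spec {d : X → X → ℝ} {r : ℝ} (hα : 1 < α) (hβ : 1 ≤ β) (hd : IsMetric d)
    (hP : P.Nontrivial) (hr : 0 ≤ r) (hε : 0 < ε)
    (hk : 16 * (α * β ^ 3 / (α - 1)) * (2 + 1 / ε) ≤ 2 ^ k) (ts out : List (BallTree X A))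
    (hts : ∀ t ∈ ts, IsGreedyTree α β d {x | x ∈ t.points} t)
    (htP : ∀ t ∈ ts, ∀ x ∈ t.points, x ∈ P) :
    (∃ L : List (BallTree X A), (searchAll d q r ε ts out).val = L ++ out ∧
      L.length ≤ doublingConst d P ^ k * ts.length ∧ (∀ v ∈ L, ∃ t ∈ ts, v ∈ t.nodes) ∧
      (∀ v ∈ L, ∀ x ∈ v.points, d q x ≤ (1 + ε) * r) ∧
      (L.flatMap BallTree.points).Subperm (ts.flatMap BallTree.points) ∧
      ∀ x ∈ ts.flatMap BallTree.points, d q x ≤ r → x ∈ L.flatMap BallTree.points) ∧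
    (searchAll d q r ε ts out).time ≤ 1 + 53 * (doublingConst d P ^ k) ^ 2 *
      (⌊Real.logb 2 (spread d P)⌋₊ + 1) * ts.length := by
  induction ts generalizing out with
  | nil => exact ⟨⟨[], rfl, by simp, by simp, by simp, by simp, by simp⟩, by simp [searchAll]⟩
  | cons t ts ih =>
    obtain ⟨⟨L₁, h1, h2, h3, h4, h5, h6⟩, h7⟩ := rangeSearch_spec (q := q) hα hβ
      (hts t List.mem_cons_self) hd hP (htP t List.mem_cons_self) hr hε hk out
    obtain ⟨⟨L₂, g1, g2, g3, g4, g5, g6⟩, g7⟩ := ih (rangeSearch d q r ε t out).val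
      (fun t ht => hts t (List.mem_cons_of_mem _ ht)) fun t ht => htP t (List.mem_cons_of_mem _ ht)
    refine ⟨⟨L₂ ++ L₁, ?_, ?_, fun v hv => ?_, fun v hv => ?_, ?_, fun x hx hq => ?_⟩, ?_⟩
    · rw [searchAll, List.append_assoc, ← h1]; exact g1
    · simp only [List.length_append, List.length_cons, Nat.mul_add]; omega
    · rcases List.mem_append.1 hv with hv | hv
      · obtain ⟨w, hw, hvw⟩ := g3 v hv
        exact ⟨w, List.mem_cons_of_mem _ hw, hvw⟩
      · exact ⟨t, List.mem_cons_self, h3 v hv⟩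
    · rcases List.mem_append.1 hv with hv | hv
      · exact g4 v hv
      · exact h4 v hv
    · rw [List.flatMap_append, List.flatMap_cons]
      exact (g5.append h5).trans List.perm_append_comm.subperm
    · rw [List.flatMap_append, List.mem_append]
      rw [List.flatMap_cons, List.mem_append] at hx
      rcases hx with hx | hx
      · exact .inr (List.mem_flatMap.2 (h6 x hx hq))
      · exact .inl (g6 x hx hq)
    · have h8 : 1 ≤ (doublingConst d P ^ k) ^ 2 * (⌊Real.logb 2 (spread d P)⌋₊ + 1) := by
        have := two_le_doublingConst hd hP
        exact Nat.one_le_iff_ne_zero.2 (by positivity)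
      change (rangeSearch d q r ε t out).time +
        (searchAll d q r ε ts (rangeSearch d q r ε t out).val).time + 1 ≤ _
      rw [List.length_cons, Nat.mul_add, mul_one]
      rw [mul_assoc] at h7
      rw [mul_assoc 53] at g7 ⊢
      omega

theorem val_report (v : BallTree X A) (acc : List X) : (report v acc).val = v.points ++ acc := by
  induction v generalizing acc with
  | leaf => rfl
  | node c s a l r ihl ihr => simp [report, ihl, ihr, BallTree.points]

/-- The time is the number of nodes of a binary tree with the given leaves. The missing step pays
for the list cell in `reportAll`, so no charge per reported node remains. -/
theorem time_report (v : BallTree X A) (acc : List X) :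
    (report v acc).time + 1 = 2 * v.points.length := by
  induction v generalizing acc with
  | leaf => rfl
  | node c s a l r ihl ihr =>
    have h1 := ihr acc
    have h2 := ihl (report r acc).val
    simp only [report, BallTree.points, List.length_append]
    omega

theorem val_reportAll (vs : List (BallTree X A)) :
    (reportAll vs).val = vs.flatMap BallTree.points := by
  induction vs with
  | nil => rfl
  | cons v vs ih => simp [reportAll, val_report, ih]

theorem time_reportAll (vs : List (BallTree X A)) :
    (reportAll vs).time = 2 * (vs.flatMap BallTree.points).length + 1 := by
  induction vs with
  | nil => rfl
  | cons v vs ih =>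
    have := time_report v (reportAll vs).val
    simp only [reportAll, List.flatMap_cons, List.length_append]
    omega

theorem val_followAux (vs : List (BallTree X A)) :
    (followAux vs).val = vs.map BallTree.aux := by
  induction vs with
  | nil => rfl
  | cons v vs ih => simp [followAux, ih]

theorem time_followAux (vs : List (BallTree X A)) : (followAux vs).time = vs.length + 1 := by
  induction vs with
  | nil => rfl
  | cons v vs ih => simp [followAux, ih]

/-- The points of a range tree are those of its primary tree. -/
def rangePoints {X : Type u} {m : ℕ} (t : RangeTree X (m + 1)) : List X :=
  BallTree.points (A := RangeTree X m) t

theorem IsGreedyRangeTree.mem_rangePoints {m : ℕ} {d : Fin (m + 1) → X → X → ℝ} {S : Set X}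
    {t : RangeTree X (m + 1)} (h : IsGreedyRangeTree α β (m + 1) d S t) {x : X} :
    x ∈ rangePoints t ↔ x ∈ S :=
  h.1.mem_points_iff

theorem IsGreedyRangeTree.setOf_rangePoints {m : ℕ} {d : Fin (m + 1) → X → X → ℝ} {S : Set X}
    {t : RangeTree X (m + 1)} (h : IsGreedyRangeTree α β (m + 1) d S t) :
    IsGreedyRangeTree α β (m + 1) d {x | x ∈ rangePoints t} t := by
  have : {x | x ∈ rangePoints t} = S := Set.ext fun x => h.mem_rangePoints
  rwa [this]

theorem IsGreedyRangeTree.nodup_rangePoints {m : ℕ} {d : Fin (m + 1) → X → X → ℝ} {S : Set X}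
    {t : RangeTree X (m + 1)} (h : IsGreedyRangeTree α β (m + 1) d S t) (hd : IsMetric (d 0))
    (hα : 1 < α) (hβ : 1 ≤ β) : (rangePoints t).Nodup := by
  obtain ⟨lam, -, hp⟩ := h.1.exists_packed hd hα hβ 0
  exact hp.nodup

/-- Correctness and cost of a query in a collection of range trees. -/
theorem queryAll_spec (hα : 1 < α) (hβ : 1 ≤ β) (hP : P.Nontrivial) (hε : 0 < ε)
    (hk : 16 * (α * β ^ 3 / (α - 1)) * (2 + 1 / ε) ≤ 2 ^ k) (hk0 : k ≠ 0) {Λ : ℕ} {m : ℕ}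
    (d : Fin (m + 1) → X → X → ℝ) (r : Fin (m + 1) → ℝ) (ts : List (RangeTree X (m + 1)))
    (hd : ∀ i, IsMetric (d i)) (hr : ∀ i, 0 ≤ r i)
    (hΛ : ∀ i, ⌊Real.logb 2 (spread (d i) P)⌋₊ + 1 ≤ Λ)
    (hts : ∀ t ∈ ts, IsGreedyRangeTree α β (m + 1) d {x | x ∈ rangePoints t} t)
    (htP : ∀ t ∈ ts, ∀ x ∈ rangePoints t, x ∈ P) :
    (queryAll q ε m d r ts).output.Subperm (ts.flatMap rangePoints) ∧
    (∀ x ∈ ts.flatMap rangePoints, (∀ i, d i q x ≤ r i) → x ∈ (queryAll q ε m d r ts).output) ∧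
    (∀ x ∈ (queryAll q ε m d r ts).output, ∀ i, d i q x ≤ (1 + ε) * r i) ∧
    (queryAll q ε m d r ts).count 0 ≤ doublingConst (d 0) P ^ k * ts.length ∧
    (∀ i : Fin m, (queryAll q ε m d r ts).count i.succ ≤
      doublingConst (d i.succ) P ^ k * (queryAll q ε m d r ts).count i.castSucc) ∧
    (queryAll q ε m d r ts).time ≤ 114 * Λ * (∏ i, doublingConst (d i) P ^ k) ^ 2 *
      (ts.length + 1) + 2 * (queryAll q ε m d r ts).output.length := by
  have hN2 : ∀ i, 2 ≤ doublingConst (d i) P ^ k := fun i =>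
    (two_le_doublingConst (hd i) hP).trans (Nat.le_self_pow hk0 _)
  have hΛ1 : 1 ≤ Λ := le_trans (Nat.le_add_left _ _) (hΛ 0)
  induction m with
  | zero =>
    obtain ⟨⟨L, h1, h2, h3, h4, h5, h6⟩, h7⟩ := searchAll_spec (A := RangeTree X 0) (q := q) hα hβ
      (hd 0) hP (hr 0) hε hk ts [] (fun t ht => (hts t ht).1) htP
    rw [List.append_nil] at h1
    have hout : (queryAll q ε 0 d r ts).output = L.flatMap BallTree.points := by
      change (reportAll (searchAll (A := RangeTree X 0) (d 0) q (r 0) ε ts []).val).val = _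
      rw [h1, val_reportAll]
    have hcount : ∀ i, (queryAll q ε 0 d r ts).count i = L.length := fun i => by
      change (searchAll (A := RangeTree X 0) (d 0) q (r 0) ε ts []).val.length = _
      rw [h1]
    have htime : (queryAll q ε 0 d r ts).time =
        (searchAll (A := RangeTree X 0) (d 0) q (r 0) ε ts []).time +
          (2 * (L.flatMap BallTree.points).length + 1) + 1 := by
      rw [← time_reportAll, ← h1]; rfl
    refine ⟨hout ▸ h5, fun x hx hq => hout ▸ h6 x hx (hq 0), fun x hx i => ?_, hcount 0 ▸ h2,
      fun i => i.elim0, ?_⟩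
    · rw [hout] at hx
      obtain ⟨v, hv, hxv⟩ := List.mem_flatMap.1 hx
      rw [Fin.eq_zero i]
      exact h4 v hv x hxv
    · rw [htime, hout, Fin.prod_univ_one]
      set N := doublingConst (d 0) P ^ k
      have h8 : 53 * N ^ 2 * (⌊Real.logb 2 (spread (d 0) P)⌋₊ + 1) * ts.length ≤
          53 * N ^ 2 * Λ * ts.length := by
        gcongr; exact hΛ 0
      have h9 : 1 * 1 ≤ N ^ 2 * Λ :=
        Nat.mul_le_mul (Nat.one_le_pow _ _ (by have := hN2 0; omega)) hΛ1
      nlinarith [Nat.zero_le (N ^ 2 * Λ * ts.length)]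
  | succ m ih =>
    obtain ⟨⟨L, h1, h2, h3, h4, h5, h6⟩, h7⟩ := searchAll_spec (A := RangeTree X (m + 1)) (q := q)
      hα hβ (hd 0) hP (hr 0) hε hk ts [] (fun t ht => (hts t ht).1) htP
    rw [List.append_nil] at h1
    set us : List (RangeTree X (m + 1)) := L.map BallTree.aux with hus
    set res := queryAll q ε m (fun i => d i.succ) (fun i => r i.succ) us with hres
    have hb : (followAux (searchAll (A := RangeTree X (m + 1)) (d 0) q (r 0) ε ts []).val).val =
        us := by
      rw [h1, val_followAux]
    have hout : (queryAll q ε (m + 1) d r ts).output = res.output := by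
      rw [hres, ← hb]; rfl
    have hcount : (queryAll q ε (m + 1) d r ts).count = Fin.cons L.length res.count := by
      rw [hres, ← hb, ← h1]; rfl
    have htime : (queryAll q ε (m + 1) d r ts).time =
        (searchAll (A := RangeTree X (m + 1)) (d 0) q (r 0) ε ts []).time + (L.length + 1) +
          res.time + 1 := by
      rw [← time_followAux, hres, ← hb, ← h1]; rfl
    have haux : ∀ v ∈ L, IsGreedyRangeTree α β (m + 1) (fun i => d i.succ) {x | x ∈ v.points}
        v.aux := fun v hv => by
      obtain ⟨t, ht, hvt⟩ := h3 v hv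
      exact (hts t ht).2 v hvt
    have hvnd : ∀ v ∈ L, v.points.Nodup := fun v hv => by
      obtain ⟨t, ht, hvt⟩ := h3 v hv
      exact ((hts t ht).nodup_rangePoints (hd 0) hα hβ).sublist (BallTree.points_sublist hvt)
    -- An auxiliary tree holds the points of its node in another order, each once.
    have hperm : (us.flatMap rangePoints).Perm (L.flatMap BallTree.points) := by
      rw [hus, List.flatMap_map]
      refine List.Perm.flatMap_left _ fun v hv => ?_
      rw [List.perm_ext_iff_of_nodup ((haux v hv).nodup_rangePoints (hd 1) hα hβ) (hvnd v hv)]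
      exact fun x => (haux v hv).mem_rangePoints
    obtain ⟨g1, g2, g3, g4, g5, g6⟩ := ih (fun i => d i.succ) (fun i => r i.succ) us
      (fun i => hd i.succ) (fun i => hr i.succ) (fun i => hΛ i.succ) (fun u hu => by
        obtain ⟨v, hv, rfl⟩ := List.mem_map.1 hu
        exact (haux v hv).setOf_rangePoints) (fun u hu x hx => by
        have hx' := hperm.subset (List.mem_flatMap.2 ⟨u, hu, hx⟩)
        obtain ⟨t, ht, hxt⟩ := List.mem_flatMap.1 (h5.subset hx')
        exact htP t ht x hxt) (fun i => hN2 i.succ)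
    rw [← hres] at g1 g2 g3 g4 g5 g6
    have huslen : us.length = L.length := List.length_map _
    rw [huslen] at g4 g6
    refine ⟨hout ▸ g1.trans (hperm.subperm.trans h5), fun x hx hq => hout ▸ ?_, fun x hx i => ?_,
      by rw [hcount]; exact h2, fun i => ?_, ?_⟩
    · exact g2 x (hperm.symm.subset (h6 x hx (hq 0))) fun i => hq i.succ
    · rw [hout] at hx
      refine Fin.cases ?_ (fun i => g3 x hx i) i
      obtain ⟨v, hv, hxv⟩ := List.mem_flatMap.1 (hperm.subset (g1.subset hx))
      exact h4 v hv x hxv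
    · rw [hcount]
      refine Fin.cases ?_ (fun j => ?_) i
      · exact g4
      · rw [Fin.castSucc_succ, Fin.cons_succ, Fin.cons_succ]
        exact g5 j
    · rw [htime, hout, Fin.prod_univ_succ, mul_pow]
      set N := doublingConst (d 0) P ^ k
      set Q := (∏ i : Fin (m + 1), doublingConst (d i.succ) P ^ k) ^ 2
      have hQ : 1 ≤ Q := Nat.one_le_pow _ _ (Finset.prod_pos fun i _ => by
        have := hN2 i.succ; omega)
      have hN : 2 ≤ N := hN2 0
      set n := ts.length
      have e1 : 53 * N ^ 2 * (⌊Real.logb 2 (spread (d 0) P)⌋₊ + 1) * n ≤ 53 * N ^ 2 * Λ * n := by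
        gcongr; exact hΛ 0
      -- Since `N ≥ 2`, the deeper levels use at most half of the constant 114, and the other 57 pay
      -- for this level. The bound is in `n + 1` so that it covers the constant steps even if no
      -- tree is left.
      have e2 : 2 * (L.length + 1) ≤ N ^ 2 * (n + 1) := by nlinarith
      have e3 : 114 * Λ * Q * (L.length + 1) ≤ 57 * (Λ * Q * (N ^ 2 * (n + 1))) := by
        calc _ = 57 * (Λ * Q * (2 * (L.length + 1))) := by ring
          _ ≤ _ := by gcongr
      have e4 : N ^ 2 * Λ * (n + 1) * 1 ≤ N ^ 2 * Λ * (n + 1) * Q := Nat.mul_le_mul_left _ hQ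
      have e5 : N ^ 2 * (n + 1) * 1 ≤ N ^ 2 * (n + 1) * Λ := Nat.mul_le_mul_left _ hΛ1
      have e6 : 4 ≤ N ^ 2 := by nlinarith
      have e7 : 4 * 1 ≤ N ^ 2 * Λ := Nat.mul_le_mul e6 hΛ1
      nlinarith

end Query

/-! ## Real exponents -/

theorem exists_two_pow_near {y : ℝ} (hy : 1 ≤ y) :
    ∃ k : ℕ, k ≠ 0 ∧ y ≤ 2 ^ k ∧ (2 : ℝ) ^ k ≤ 2 * y := by
  obtain ⟨n, h1, h2⟩ := exists_nat_pow_near hy one_lt_two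
  exact ⟨n + 1, n.succ_ne_zero, h2.le, by rw [pow_succ]; linarith⟩

theorem one_le_doublingDim {X : Type u} {d : X → X → ℝ} {P : Finset X} (hd : IsMetric d)
    (hP : P.Nontrivial) : 1 ≤ doublingDim d P := by
  have h2 : (2 : ℝ) ≤ doublingConst d P := by exact_mod_cast two_le_doublingConst hd hP
  rw [doublingDim, Real.le_logb_iff_rpow_le one_lt_two (by linarith), Real.rpow_one]
  exact h2

/-- Exchanging exponents, `ρ ^ k = (2 ^ δ) ^ k = (2 ^ k) ^ δ`; the constant `K` becomes a power of
`B` because `B ≥ 2`. -/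
theorem doublingConst_pow_le {X : Type u} {d : X → X → ℝ} {P : Finset X} (hd : IsMetric d)
    (hP : P.Nontrivial) {B K : ℝ} (hB : 2 ≤ B) (hK : 1 ≤ K) {k : ℕ} (hk : (2 : ℝ) ^ k ≤ K * B) :
    ((doublingConst d P ^ k : ℕ) : ℝ) ≤ B ^ ((Real.logb 2 K + 1) * doublingDim d P) := by
  have h2 : (2 : ℝ) ≤ doublingConst d P := by exact_mod_cast two_le_doublingConst hd hP
  have hδ := one_le_doublingDim hd hP
  have hK0 : 0 < K := by linarith
  have h3 : (doublingConst d P : ℝ) = 2 ^ doublingDim d P :=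
    (Real.rpow_logb two_pos (by norm_num) (by linarith)).symm
  have h4 : K ≤ B ^ Real.logb 2 K := by
    calc K = 2 ^ Real.logb 2 K := (Real.rpow_logb two_pos (by norm_num) hK0).symm
      _ ≤ _ := Real.rpow_le_rpow two_pos.le hB (Real.logb_nonneg one_lt_two hK)
  push_cast
  calc ((doublingConst d P : ℝ)) ^ k = ((2 : ℝ) ^ k) ^ doublingDim d P := by
        rw [h3, ← Real.rpow_natCast, ← Real.rpow_natCast, ← Real.rpow_mul two_pos.le,
          ← Real.rpow_mul two_pos.le, mul_comm]
    _ ≤ (B ^ (Real.logb 2 K + 1)) ^ doublingDim d P := by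
        refine Real.rpow_le_rpow (by positivity) (hk.trans ?_) (by linarith)
        rw [Real.rpow_add (by linarith), Real.rpow_one]
        gcongr
    _ = _ := (Real.rpow_mul (by linarith) _ _).symm

end GreedyRange

/-! ### The query bound with real exponents -/

theorem mainTheorem4 (α β : ℝ) (hα : 1 < α) (hβ : 1 ≤ β) :
    ∃ C : ℝ, 0 < C ∧
      ∀ (X : Type u) (m : ℕ) (M : Fin (m + 1) → MetricSpace X) (P : Finset X)
        (t : GreedyRange.RangeTree X (m + 1)) (q : X) (r : Fin (m + 1) → ℝ) (ε : ℝ),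
        P.Nontrivial →
        GreedyRange.IsGreedyRangeTree α β (m + 1) (fun i => (M i).dist) (P : Set X) t →
        (∀ i, 0 ≤ r i) → 0 < ε →
        let δ : Fin (m + 1) → ℝ := fun i => GreedyRange.doublingDim (M i).dist P
        let Δ : ℝ := ⨆ i, GreedyRange.spread (M i).dist P
        let res := GreedyRange.query (fun i => (M i).dist) t q r ε
        res.output.Nodup ∧
        (∀ x ∈ P, (∀ i, (M i).dist q x ≤ r i) → x ∈ res.output) ∧
        (∀ x ∈ res.output, x ∈ P ∧ ∀ i, (M i).dist q x ≤ (1 + ε) * r i) ∧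
        (res.count 0 : ℝ) ≤ (2 + 1 / ε) ^ (C * δ 0) ∧
        (∀ i : Fin m, (res.count i.succ : ℝ) ≤
          (2 + 1 / ε) ^ (C * δ i.succ) * (res.count i.castSucc : ℝ)) ∧
        (res.time : ℝ) ≤
          (2 + 1 / ε) ^ (C * ∑ i, δ i) * (1 + Real.logb 2 Δ) + C * (res.output.length : ℝ) := by
  have hα' : 0 < α - 1 := by linarith
  set K := α * β ^ 3 / (α - 1) with hK
  have hK1 : 1 ≤ K := by
    rw [hK, one_le_div hα']
    have : 1 ≤ β ^ 3 := one_le_pow₀ hβ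
    nlinarith
  -- The power of two nearest above `16 * K * B` is at most `32 * K * B`.
  set C₀ := Real.logb 2 (32 * K) + 1 with hC₀
  have hC₀1 : 1 ≤ C₀ := by
    have := Real.logb_nonneg one_lt_two (by linarith : 1 ≤ 32 * K)
    linarith
  -- `2 * C₀` comes from the squared product of the packing bounds, and 8 from `228 ≤ 2 ^ 8`.
  refine ⟨2 * C₀ + 8, by linarith, fun X m M P t q r ε hP ht hr hε => ?_⟩
  intro δ Δ res
  have hd : ∀ i, GreedyRange.IsMetric (M i).dist := fun i => GreedyRange.isMetric_dist (M i)
  set B := 2 + 1 / ε with hB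
  have hB2 : 2 ≤ B := by
    have : 0 < 1 / ε := by positivity
    linarith
  have hB1 : 1 ≤ B := by linarith
  obtain ⟨k, hk0, hk1, hk2⟩ := GreedyRange.exists_two_pow_near
    (y := 16 * K * B) (by nlinarith)
  have hδ : ∀ i, 1 ≤ δ i := fun i => GreedyRange.one_le_doublingDim (hd i) hP
  have hN : ∀ i, ((GreedyRange.doublingConst (M i).dist P ^ k : ℕ) : ℝ) ≤ B ^ (C₀ * δ i) :=
    fun i => GreedyRange.doublingConst_pow_le (hd i) hP hB2 (by linarith) (by linarith)
  have hNC : ∀ i, ((GreedyRange.doublingConst (M i).dist P ^ k : ℕ) : ℝ) ≤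
      B ^ ((2 * C₀ + 8) * δ i) := fun i =>
    (hN i).trans (Real.rpow_le_rpow_of_exponent_le hB1 (by nlinarith [hδ i]))
  have hsΔ : ∀ i, GreedyRange.spread (M i).dist P ≤ Δ := fun i =>
    le_ciSup (Set.finite_range fun i => GreedyRange.spread (M i).dist P).bddAbove i
  have hs1 : ∀ i, 1 ≤ GreedyRange.spread (M i).dist P := fun i => GreedyRange.one_le_spread (hd i) hP
  have hΛ : ∀ i, ⌊Real.logb 2 (GreedyRange.spread (M i).dist P)⌋₊ + 1 ≤
      ⌊Real.logb 2 Δ⌋₊ + 1 := fun i => Nat.succ_le_succ (Nat.floor_le_floor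
    (Real.logb_le_logb_of_le one_lt_two (by linarith [hs1 i]) (hsΔ i)))
  have hlog : 0 ≤ Real.logb 2 Δ := Real.logb_nonneg one_lt_two ((hs1 0).trans (hsΔ 0))
  have hmem : ∀ x, x ∈ GreedyRange.rangePoints t ↔ x ∈ P := fun x => ht.mem_rangePoints
  obtain ⟨g1, g2, g3, g4, g5, g6⟩ := GreedyRange.queryAll_spec (q := q) hα hβ hP hε hk1 hk0
    (fun i => (M i).dist) r [t] hd hr hΛ
    (fun u hu => by rw [List.mem_singleton.1 hu]; exact ht.setOf_rangePoints)
    (fun u hu x hx => by rw [List.mem_singleton.1 hu] at hx; exact (hmem x).1 hx)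
  change res.output.Subperm _ at g1
  change ∀ x ∈ _, _ → x ∈ res.output at g2
  change ∀ x ∈ res.output, _ at g3
  change res.count 0 ≤ _ at g4
  change ∀ i : Fin m, res.count i.succ ≤ _ * res.count i.castSucc at g5
  change res.time ≤ _ + 2 * res.output.length at g6
  rw [List.flatMap_singleton] at g1 g2
  rw [List.length_singleton] at g4 g6
  refine ⟨?_, fun x hx => g2 x ((hmem x).2 hx), fun x hx => ⟨(hmem x).1 (g1.subset hx), g3 x hx⟩,
    ?_, fun i => ?_, ?_⟩
  · obtain ⟨l, hl, hsub⟩ := g1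
    exact hl.nodup_iff.1 ((ht.nodup_rangePoints (hd 0) hα hβ).sublist hsub)
  · refine le_trans ?_ (hNC 0)
    exact_mod_cast g4.trans_eq (mul_one _)
  · refine le_trans (b := ((GreedyRange.doublingConst (M i.succ).dist P ^ k : ℕ) : ℝ) *
      (res.count i.castSucc : ℝ)) ?_ (by gcongr; exact hNC i.succ)
    exact_mod_cast g5 i
  · have hprod : ((∏ i, GreedyRange.doublingConst (M i).dist P ^ k : ℕ) : ℝ) ≤
        B ^ (C₀ * ∑ i, δ i) := by
      rw [Nat.cast_prod, Finset.mul_sum, Real.rpow_sum_of_pos (by linarith)]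
      exact Finset.prod_le_prod (fun i _ => Nat.cast_nonneg _) fun i _ => hN i
    have hsum : 1 ≤ ∑ i, δ i := (hδ 0).trans
      (Finset.single_le_sum (f := δ) (fun i _ => by linarith [hδ i]) (Finset.mem_univ 0))
    have h228 : (228 : ℝ) ≤ B ^ (8 * ∑ i, δ i) := by
      calc (228 : ℝ) ≤ 2 ^ (8 : ℝ) := by norm_num
        _ ≤ B ^ (8 : ℝ) := Real.rpow_le_rpow two_pos.le hB2 (by norm_num)
        _ ≤ _ := Real.rpow_le_rpow_of_exponent_le hB1 (by linarith)
    have hfloor : ((⌊Real.logb 2 Δ⌋₊ + 1 : ℕ) : ℝ) ≤ 1 + Real.logb 2 Δ := by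
      push_cast
      linarith [Nat.floor_le hlog]
    have hg6 : (res.time : ℝ) ≤ 114 * ((⌊Real.logb 2 Δ⌋₊ + 1 : ℕ) : ℝ) *
        ((∏ i, GreedyRange.doublingConst (M i).dist P ^ k : ℕ) : ℝ) ^ 2 * (1 + 1) +
        2 * (res.output.length : ℝ) := by
      exact_mod_cast g6
    refine hg6.trans (add_le_add ?_ ?_)
    · calc _ = 228 * ((∏ i, GreedyRange.doublingConst (M i).dist P ^ k : ℕ) : ℝ) ^ 2 *
            ((⌊Real.logb 2 Δ⌋₊ + 1 : ℕ) : ℝ) := by ring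
        _ ≤ B ^ (8 * ∑ i, δ i) * (B ^ (C₀ * ∑ i, δ i)) ^ 2 * (1 + Real.logb 2 Δ) := by gcongr
        _ = _ := by
          rw [pow_two, ← Real.rpow_add (by linarith), ← Real.rpow_add (by linarith)]
          congr 2
          ring
    · gcongr
      linarith
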